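/- Let $\mathcal F$ be a Frobenius category, that is, an additive category with an exact structure in the sense of Quillen (a class of kernel–cokernel pairs $0\to X\to Y\to Z\to 0$, called conflations; their first morphisms are called inflations) having enough projectives and enough injectives, and whose projective objects coincide with its injective objects. Let $\mathcal P\subset\mathcal F$ be the full subcategory of projective-injective objects and assume that $\mathcal P$ is idempotent complete. Let $\mathsf K(\mathcal P)$ be the homotopy category of complexes over $\mathcal P$. Let $\mathsf K^{-,\mathrm b}(\mathcal P)\subset\mathsf K(\mathcal P)$ be the full triangulated subcategory of objects isomorphic to a complex $X=(X^i,d^i\colon X^i\to X^{i+1})$ such that (a) there is $n_X\in\mathbb Z$ with $X^i=0$ for all $i>n_X$; (b) there are $m_X\in\mathbb Z$ and conflations $0\to Y^{i-1}\xrightarrow{a^{i-1}}X^i\xrightarrow{b^i}Y^i\to0$ in $\mathcal F$ for all $i\le m_X$, such that $d^i=a^ib^i$ for all $i<m_X$. Let $\mathsf K^{\mathrm b}(\mathcal P)$, $\mathsf K^{>0}(\mathcal P)$ and $\mathsf K^{<0}(\mathcal P)$ be the full subcategories of objects of $\mathsf K(\mathcal P)$ isomorphic to a bounded complex $X$, respectively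 to a bounded complex with $X^i=0$ for $i\le0$, respectively to a bounded complex with $X^i=0$ for $i\ge0$. Sending an object of $\mathcal F$ to its projective resolution, placed in degrees $\le 0$, defines a functor $\mathcal F\to\mathsf K^{-,\mathrm b}(\mathcal P)$. This functor is fully faithful, and its essential image consists of the objects isomorphic to some $X$ for which one can take $n_X\le0\le m_X$; we identify $\mathcal F$ with this full subcategory. For full subcategories $\mathcal X,\mathcal Y$ of a triangulated category, $\mathcal X*\mathcal Y$ denotes the full subcategory of the objects $T$ that fit into a triangle $X\to T\to Y\to X[1]$ with $X\in\mathcal X$ and $Y\in\mathcal Y$, and one writes $\mathcal X\perp\mathcal Y$ for $\mathcal X*\mathcal Y$ if $\operatorname{Hom}(\mathcal X,\mathcal Y)=0$. Then there is a decomposition $$\mathsf K^{-,\mathrm b}(\mathcal P)=\mathsf K^{>0}(\mathcal P)\perp\mathcal F\perp\mathsf K^{<0}(\mathcal P).$$ Let $\underline{\mathcal F}=\mathcal F/[\mathcal P]$ be the stable category, whose morphisms are the morphisms of $\mathcal F$ modulo those factoring through an object of $\mathcal P$, with Happel's triangulated structure: choose for each $A\in\mathcal F$ a conflation $0\to A\to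 I(A)\to\Sigma A\to0$ with $I(A)$ injective; then $\Sigma$ induces the suspension functor of $\underline{\mathcal F}$, and the triangles are the diagrams isomorphic in $\underline{\mathcal F}$ to the images of $A\xrightarrow{u}B\xrightarrow{v}C\xrightarrow{w}\Sigma A$, where $C$ is the pushout of $u$ and $A\to I(A)$, and $w$ is induced by $0\colon B\to\Sigma A$ and by $I(A)\to\Sigma A$. Then the composition $\mathcal F\subset\mathsf K^{-,\mathrm b}(\mathcal P)\to\mathsf K^{-,\mathrm b}(\mathcal P)/\mathsf K^{\mathrm b}(\mathcal P)$ with the Verdier quotient functor induces a triangle equivalence $$\underline{\mathcal F}\xrightarrow{\ \simeq\ }\mathsf K^{-,\mathrm b}(\mathcal P)/\mathsf K^{\mathrm b}(\mathcal P).$$ -/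

import Mathlib

open CategoryTheory Category Limits Pretriangulated

universe v u

set_option linter.unusedSectionVars false

/-- `f` is the first morphism of a short complex belonging to the class `conf`. -/
def IsInflationOf {F : Type u} [Category.{v} F] [Preadditive F]
    (conf : ObjectProperty (ShortComplex F)) {X Y : F} (f : X ⟶ Y) : Prop :=
  ∃ (Z : F) (g : Y ⟶ Z) (w : f ≫ g = 0), conf (ShortComplex.mk f g w)

/-- `g` is the second morphism of a short complex belonging to the class `conf`. -/
def IsDeflationOf {F : Type u} [Category.{v} F] [Preadditive F]
    (conf : ObjectProperty (ShortComplex F)) {Y Z : F} (g : Y ⟶ Z) : Prop :=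
  ∃ (X : F) (f : X ⟶ Y) (w : f ≫ g = 0), conf (ShortComplex.mk f g w)

/-- An exact structure in the sense of Quillen on an additive category `F`: a class of
kernel-cokernel pairs (the conflations), closed under isomorphisms, such that
identities are inflations and deflations, inflations and deflations are closed under
composition, the pushout of an inflation along an arbitrary morphism exists and is an inflation,
and dually the pullback of a deflation exists and is a deflation. -/
structure ExactStructure (F : Type u) [Category.{v} F] [Preadditive F] where
  /-- the class of conflations -/
  conf : ObjectProperty (ShortComplex F)
  iso_closed : conf.IsClosedUnderIsomorphisms
  isKernel : ∀ S : ShortComplex F, conf S → Nonempty (IsLimit (KernelFork.ofι S.f S.zero))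
  isCokernel : ∀ S : ShortComplex F, conf S →
    Nonempty (IsColimit (CokernelCofork.ofπ S.g S.zero))
  id_inflation : ∀ X : F, IsInflationOf conf (𝟙 X)
  id_deflation : ∀ X : F, IsDeflationOf conf (𝟙 X)
  comp_inflation : ∀ {X Y Z : F} (f : X ⟶ Y) (g : Y ⟶ Z),
    IsInflationOf conf f → IsInflationOf conf g → IsInflationOf conf (f ≫ g)
  comp_deflation : ∀ {X Y Z : F} (f : X ⟶ Y) (g : Y ⟶ Z),
    IsDeflationOf conf f → IsDeflationOf conf g → IsDeflationOf conf (f ≫ g)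
  pushout_inflation : ∀ {X Y X' : F} (f : X ⟶ Y) (g : X ⟶ X'), IsInflationOf conf f →
    ∃ (Y' : F) (g' : Y ⟶ Y') (f' : X' ⟶ Y'), IsPushout f g g' f' ∧ IsInflationOf conf f'
  pullback_deflation : ∀ {Y Z Z' : F} (p : Y ⟶ Z) (h : Z' ⟶ Z), IsDeflationOf conf p →
    ∃ (Y' : F) (h' : Y' ⟶ Y) (p' : Y' ⟶ Z'), IsPullback h' p' p h ∧ IsDeflationOf conf p'

namespace ExactStructure

section Basic

variable {F : Type u} [Category.{v} F] [Preadditive F] (E : ExactStructure F)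

abbrev IsInflation {X Y : F} (f : X ⟶ Y) : Prop := IsInflationOf E.conf f

abbrev IsDeflation {Y Z : F} (g : Y ⟶ Z) : Prop := IsDeflationOf E.conf g

/-- `P` is projective relative to the conflations. -/
def IsProj (P : F) : Prop :=
  ∀ ⦃Y Z : F⦄ (g : Y ⟶ Z), E.IsDeflation g → ∀ h : P ⟶ Z, ∃ k : P ⟶ Y, k ≫ g = h

/-- `I` is injective relative to the conflations. -/
def IsInj (I : F) : Prop :=
  ∀ ⦃X Y : F⦄ (f : X ⟶ Y), E.IsInflation f → ∀ h : X ⟶ I, ∃ k : Y ⟶ I, f ≫ k = h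

/-- The class of projective-injective objects. -/
def projInj : ObjectProperty F := fun A => E.IsProj A ∧ E.IsInj A

/-- A Frobenius category: an exact category with enough projectives and enough injectives,
whose projective objects are exactly its injective objects. -/
class IsFrobenius : Prop where
  enough_proj : ∀ A : F, ∃ (P : F) (p : P ⟶ A), E.IsProj P ∧ E.IsDeflation p
  enough_inj : ∀ A : F, ∃ (I : F) (i : A ⟶ I), E.IsInj I ∧ E.IsInflation i
  proj_iff_inj : ∀ A : F, E.IsProj A ↔ E.IsInj A

/-- The category `P` of projective-injective objects. -/
abbrev ProjInj := E.projInj.FullSubcategory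

variable {E}

lemma conf_mono {S : ShortComplex F} (h : E.conf S) : Mono S.f :=
  (⟨fun _ _ w => Fork.IsLimit.hom_ext (E.isKernel S h).some w⟩ : Mono S.f)

lemma conf_epi {S : ShortComplex F} (h : E.conf S) : Epi S.g :=
  (⟨fun _ _ w => Cofork.IsColimit.hom_ext (E.isCokernel S h).some w⟩ : Epi S.g)

lemma conf_lift {S : ShortComplex F} (h : E.conf S) {A : F} (k : A ⟶ S.X₂) (w : k ≫ S.g = 0) :
    ∃ l : A ⟶ S.X₁, l ≫ S.f = k := by
  obtain ⟨l, hl⟩ := KernelFork.IsLimit.lift' (E.isKernel S h).some k w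
  exact ⟨l, hl⟩

lemma conf_desc {S : ShortComplex F} (h : E.conf S) {A : F} (k : S.X₂ ⟶ A) (w : S.f ≫ k = 0) :
    ∃ l : S.X₃ ⟶ A, S.g ≫ l = k := by
  obtain ⟨l, hl⟩ := CokernelCofork.IsColimit.desc' (E.isCokernel S h).some k w
  exact ⟨l, hl⟩

/-- A deflation together with any kernel of it is a conflation. -/
lemma conf_of_deflation {A B C : F} (i : A ⟶ B) (p : B ⟶ C) (w : i ≫ p = 0)
    (hp : E.IsDeflation p) [Mono i]
    (hi : ∀ {T : F} (t : T ⟶ B), t ≫ p = 0 → ∃ l : T ⟶ A, l ≫ i = t) :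
    E.conf (ShortComplex.mk i p w) := by
  obtain ⟨K, k, hk, hc⟩ := hp
  have := E.iso_closed
  have : Mono k := conf_mono hc
  obtain ⟨l, hl⟩ := hi k hk
  obtain ⟨m, hm⟩ := conf_lift hc i w
  dsimp at m hm
  let e : K ≅ A :=
    { hom := l
      inv := m
      hom_inv_id := by rw [← cancel_mono k, assoc, hm, hl, id_comp]
      inv_hom_id := by rw [← cancel_mono i, assoc, hl, hm, id_comp] }
  refine E.conf.prop_of_iso (ShortComplex.isoMk
    (S₁ := ShortComplex.mk k p hk) (S₂ := ShortComplex.mk i p w) e (Iso.refl _) (Iso.refl _) ?_ ?_) hc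
  · dsimp [e]; simp [hl]
  · dsimp; simp

open ZeroObject in
lemma projInj_zero [HasZeroObject F] : E.projInj (0 : F) :=
  ⟨fun _ _ _ _ _ => ⟨0, (isZero_zero F).eq_of_src _ _⟩,
    fun _ _ _ _ _ => ⟨0, (isZero_zero F).eq_of_tgt _ _⟩⟩

lemma projInj_biprod [HasBinaryBiproducts F] {A B : F} (hA : E.projInj A) (hB : E.projInj B) :
    E.projInj (A ⊞ B) := by
  constructor
  · intro Y Z g hg h
    obtain ⟨k, hk⟩ := hA.1 g hg (biprod.inl ≫ h)
    obtain ⟨l, hl⟩ := hB.1 g hg (biprod.inr ≫ h)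
    exact ⟨biprod.desc k l, by ext <;> simp [hk, hl]⟩
  · intro Y Z g hg h
    obtain ⟨k, hk⟩ := hA.2 g hg (h ≫ biprod.fst)
    obtain ⟨l, hl⟩ := hB.2 g hg (h ≫ biprod.snd)
    exact ⟨biprod.lift k l, by ext <;> simp [hk, hl]⟩

instance [HasZeroObject F] : HasZeroObject E.ProjInj :=
  ⟨⟨⟨_, projInj_zero⟩, ⟨fun Y => ⟨⟨⟨0⟩, fun f => by
      ext⟩⟩,
    fun Y => ⟨⟨⟨0⟩, fun f => by ext⟩⟩⟩⟩⟩

instance [HasBinaryBiproducts F] : HasBinaryBiproducts E.ProjInj where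
  has_binary_biproduct A B :=
    hasBinaryBiproduct_of_total (X := A) (Y := B)
      { pt := ⟨A.obj ⊞ B.obj, projInj_biprod A.property B.property⟩
        fst := ObjectProperty.homMk biprod.fst
        snd := ObjectProperty.homMk biprod.snd
        inl := ObjectProperty.homMk biprod.inl
        inr := ObjectProperty.homMk biprod.inr }
      (by apply ObjectProperty.hom_ext; exact biprod.total)

end Basic
end ExactStructure

namespace ExactStructure

section Cone

variable {F : Type u} [Category.{v} F] [Preadditive F] {E : ExactStructure F}

lemma isPullback_of {P X Y Z : F} (h' : P ⟶ X) (p' : P ⟶ Y) (p : X ⟶ Z) (h : Y ⟶ Z)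
    (w : h' ≫ p = p' ≫ h)
    (hex : ∀ {T : F} (a : T ⟶ X) (b : T ⟶ Y), a ≫ p = b ≫ h →
      ∃ l : T ⟶ P, l ≫ h' = a ∧ l ≫ p' = b)
    (huniq : ∀ {T : F} (l l' : T ⟶ P), l ≫ h' = l' ≫ h' → l ≫ p' = l' ≫ p' → l = l') :
    IsPullback h' p' p h :=
  ⟨⟨w⟩, ⟨PullbackCone.IsLimit.mk w (fun s => (hex s.fst s.snd s.condition).choose)
    (fun s => (hex s.fst s.snd s.condition).choose_spec.1)
    (fun s => (hex s.fst s.snd s.condition).choose_spec.2)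
    (fun s _ h₁ h₂ => huniq _ _
      (h₁.trans (hex s.fst s.snd s.condition).choose_spec.1.symm)
      (h₂.trans (hex s.fst s.snd s.condition).choose_spec.2.symm))⟩⟩

lemma deflation_of_isPullback {P X Y Z : F} {h' : P ⟶ X} {p' : P ⟶ Y} {p : X ⟶ Z} {h : Y ⟶ Z}
    (sq : IsPullback h' p' p h) (hp : E.IsDeflation p) : E.IsDeflation p' := by
  obtain ⟨Q, k', q', sq', K, i, hi, hc⟩ := E.pullback_deflation p h hp
  have := E.iso_closed
  let e : Q ≅ P := sq'.isoIsPullback _ _ sq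
  have he : e.hom ≫ p' = q' := IsPullback.isoIsPullback_hom_snd _ _ sq' sq
  have w : (i ≫ e.hom) ≫ p' = 0 := by rw [assoc, he, hi]
  refine ⟨K, i ≫ e.hom, w, E.conf.prop_of_iso (ShortComplex.isoMk
    (S₁ := ShortComplex.mk i q' hi) (S₂ := ShortComplex.mk _ p' w)
    (Iso.refl _) e (Iso.refl _) ?_ ?_) hc⟩
  · dsimp; simp
  · dsimp; simp [he]

lemma conf_cone [HasBinaryBiproducts F] {A₁ X₂ A₂ Y₁ B₁ Y₂ B₂ C₀ C₁ S : F}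
    (aX : A₁ ⟶ X₂) (bX : X₂ ⟶ A₂) (wX : aX ≫ bX = 0) (hX : E.conf (ShortComplex.mk aX bX wX))
    (bY : Y₁ ⟶ B₁) (hbY : E.IsDeflation bY)
    (aY : B₁ ⟶ Y₂) (bY' : Y₂ ⟶ B₂) (wY : aY ≫ bY' = 0)
    (hY : E.conf (ShortComplex.mk aY bY' wY))
    (f : X₂ ⟶ Y₂) (g₁ : A₁ ⟶ B₁) (g₂ : A₂ ⟶ B₂)
    (comm₁ : aX ≫ f = g₁ ≫ aY) (comm₂ : bX ≫ g₂ = f ≫ bY')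
    (p₀ : C₀ ⟶ A₁) (q₀ : C₀ ⟶ Y₁) (sq₀ : IsPullback p₀ q₀ g₁ bY)
    (p₁ : C₁ ⟶ A₂) (q₁ : C₁ ⟶ Y₂) (sq₁ : IsPullback p₁ q₁ g₂ bY')
    (inl : X₂ ⟶ S) (inr : Y₁ ⟶ S) (fst : S ⟶ X₂) (snd : S ⟶ Y₁)
    (h₁ : inl ≫ fst = 𝟙 _) (h₂ : inr ≫ snd = 𝟙 _) (h₃ : inl ≫ snd = 0) (h₄ : inr ≫ fst = 0)
    (h₅ : fst ≫ inl + snd ≫ inr = 𝟙 S)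
    (α : C₀ ⟶ S) (hα₁ : α ≫ fst = -(p₀ ≫ aX)) (hα₂ : α ≫ snd = q₀)
    (β : S ⟶ C₁) (hβ₁ : β ≫ p₁ = fst ≫ bX) (hβ₂ : β ≫ q₁ = fst ≫ f + snd ≫ bY ≫ aY) :
    ∃ w : α ≫ β = 0, E.conf (ShortComplex.mk α β w) := by
  have : Mono aX := conf_mono hX
  have : Mono aY := conf_mono hY
  have hS : ∀ {T : F} (s t : T ⟶ S), s ≫ fst = t ≫ fst → s ≫ snd = t ≫ snd → s = t := by
    intro T s t hs ht
    rw [← comp_id s, ← comp_id t, ← h₅, Preadditive.comp_add, Preadditive.comp_add,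
      ← assoc, ← assoc, ← assoc, ← assoc, hs, ht]
  have w : α ≫ β = 0 := by
    apply sq₁.hom_ext
    · rw [assoc, hβ₁, reassoc_of% hα₁]
      simp [wX]
    · rw [assoc, hβ₂, Preadditive.comp_add, reassoc_of% hα₁, reassoc_of% hα₂]
      simp [comm₁, ← sq₀.w_assoc]
  -- the two deflations whose composition is `β`
  let r : S ⟶ X₂ ⊞ B₁ := biprod.lift fst (snd ≫ bY)
  have hr : E.IsDeflation r := by
    refine deflation_of_isPullback (isPullback_of snd r bY biprod.snd (by simp [r]) ?_ ?_) hbY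
    · intro T a b hab
      refine ⟨(b ≫ biprod.fst) ≫ inl + a ≫ inr, by simp [h₂, h₃], ?_⟩
      ext
      · simp [r, h₁, h₄]
      · simp [r, reassoc_of% h₃, reassoc_of% h₂, hab]
    · intro T l l' hl hl'
      refine hS _ _ ?_ hl
      simpa [r] using hl' =≫ biprod.fst
  obtain ⟨t, ht₁, ht₂⟩ : ∃ t : X₂ ⊞ B₁ ⟶ C₁, t ≫ p₁ = biprod.fst ≫ bX ∧
      t ≫ q₁ = biprod.fst ≫ f + biprod.snd ≫ aY :=
    ⟨sq₁.lift (biprod.fst ≫ bX) (biprod.fst ≫ f + biprod.snd ≫ aY) (by simp [comm₂, wY]),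
      by simp, by simp⟩
  have htd : E.IsDeflation t := by
    refine deflation_of_isPullback (isPullback_of biprod.fst t bX p₁ ht₁.symm ?_ ?_)
      ⟨_, _, wX, hX⟩
    · intro T a c hac
      obtain ⟨l, hl⟩ := conf_lift hY (c ≫ q₁ - a ≫ f) (by
        dsimp
        rw [Preadditive.sub_comp, assoc, assoc, ← sq₁.w, ← comm₂, ← assoc, ← assoc, hac, sub_self])
      dsimp at hl
      refine ⟨biprod.lift a l, by simp, ?_⟩
      apply sq₁.hom_ext
      · simp [ht₁, hac]
      · simp [ht₂, hl]
    · intro T l l' hl hl'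
      ext
      · exact hl
      · rw [← cancel_mono aY]
        have := hl' =≫ q₁
        simp only [assoc, ht₂, Preadditive.comp_add, reassoc_of% hl] at this
        simpa using this
  have hβ : β = r ≫ t := by
    apply sq₁.hom_ext
    · simp [hβ₁, ht₁, r]
    · simp [hβ₂, ht₂, r]
  have hβd : E.IsDeflation β := by
    rw [hβ]
    exact E.comp_deflation _ _ hr htd
  have : Mono α := ⟨fun s t hst => by
    apply sq₀.hom_ext
    · rw [← cancel_mono aX]
      have := hst =≫ fst
      simpa [hα₁] using this
    · have := hst =≫ snd
      simpa [hα₂] using this⟩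
  refine ⟨w, conf_of_deflation α β w hβd ?_⟩
  intro T s hs
  have hs₁ : (s ≫ fst) ≫ bX = 0 := by
    rw [assoc, ← hβ₁, reassoc_of% hs, zero_comp]
  have hs₂ : s ≫ fst ≫ f + s ≫ snd ≫ bY ≫ aY = 0 := by
    rw [← Preadditive.comp_add, ← hβ₂, reassoc_of% hs, zero_comp]
  obtain ⟨l, hl⟩ := conf_lift hX (s ≫ fst) hs₁
  dsimp at hl
  refine ⟨sq₀.lift (-l) (s ≫ snd) ?_, ?_⟩
  · rw [← cancel_mono aY]
    rw [← reassoc_of% hl, comm₁] at hs₂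
    simp only [assoc, Preadditive.neg_comp]
    exact neg_eq_of_add_eq_zero_right hs₂
  · apply hS
    · simp [hα₁, hl]
    · simp [hα₂]

end Cone
end ExactStructure

namespace ExactStructure

section Complexes

variable {F : Type u} [Category.{v} F] [Preadditive F] [HasZeroObject F] [HasBinaryBiproducts F]
  (E : ExactStructure F)

/-- The homotopy category `K(P)` of complexes of projective-injective objects. -/
abbrev KP := HomotopyCategory E.ProjInj (ComplexShape.up ℤ)

/-- There are an integer-indexed family `Y` and, for `i ≤ m`, conflations
`Y^{i-1} ⟶ X^i ⟶ Y^i` in `F` (with morphisms `a^{i-1}` and `b^i`) such that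
`d^i = a^i b^i` for `i < m`. (Here the conflation in degree `i + 1 ≤ m` is indexed by `i`;
the values of `Y`, `a`, `b` in other degrees are irrelevant.) -/
def ConflationsUpTo (X : CochainComplex E.ProjInj ℤ) (m : ℤ) : Prop :=
  ∃ (Y : ℤ → F) (a : ∀ i, Y i ⟶ (X.X (i + 1)).obj) (b : ∀ i, (X.X i).obj ⟶ Y i),
    ∀ i, i < m → (X.d i (i + 1)).hom = b i ≫ a i ∧
      ∃ w : a i ≫ b (i + 1) = 0, E.conf (ShortComplex.mk (a i) (b (i + 1)) w)

/-- The bounded above complexes with conflations in low degrees. -/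
def minusB : ObjectProperty (CochainComplex E.ProjInj ℤ) := fun X =>
  (∃ n : ℤ, ∀ i, n < i → IsZero (X.X i)) ∧ ∃ m : ℤ, E.ConflationsUpTo X m

/-- The bounded complexes. -/
def bounded : ObjectProperty (CochainComplex E.ProjInj ℤ) := fun X =>
  (∃ n : ℤ, ∀ i, n < i → IsZero (X.X i)) ∧ ∃ m : ℤ, ∀ i, i < m → IsZero (X.X i)

variable {E}

lemma ConflationsUpTo.mono {X : CochainComplex E.ProjInj ℤ} {m m' : ℤ}
    (h : E.ConflationsUpTo X m) (hm : m' ≤ m) : E.ConflationsUpTo X m' := by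
  obtain ⟨Y, a, b, h⟩ := h
  exact ⟨Y, a, b, fun i hi => h i (by lia)⟩

lemma ConflationsUpTo.mappingCone {X Y : CochainComplex E.ProjInj ℤ} (φ : X ⟶ Y) {m : ℤ}
    (hX : E.ConflationsUpTo X m) (hY : E.ConflationsUpTo Y m) :
    E.ConflationsUpTo (CochainComplex.mappingCone φ) (m - 2) := by
  obtain ⟨A, aX, bX, hX⟩ := hX
  obtain ⟨B, aY, bY, hY⟩ := hY
  have hφ : ∀ i j, (φ.f i).hom ≫ (Y.d i j).hom = (X.d i j).hom ≫ (φ.f j).hom := fun i j =>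
    E.projInj.ι.congr_map (φ.comm i j)
  have epiX : ∀ j, j < m → Epi (bX j) := fun j hj => by
    obtain ⟨k, rfl⟩ : ∃ k, j = k + 1 := ⟨j - 1, by lia⟩
    exact conf_epi (hX k (by lia)).2.choose_spec
  have hg : ∀ j, ∃ g : A j ⟶ B j, j < m →
      bX j ≫ g = (φ.f j).hom ≫ bY j ∧ aX j ≫ (φ.f (j + 1)).hom = g ≫ aY j := by
    intro j
    by_cases hj : j < m
    · obtain ⟨k, rfl⟩ : ∃ k, j = k + 1 := ⟨j - 1, by lia⟩
      have := epiX k (by lia)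
      have := epiX (k + 1) hj
      obtain ⟨dX, wX, cX⟩ := hX k (by lia)
      obtain ⟨dY, wY, cY⟩ := hY k (by lia)
      obtain ⟨g, hg⟩ := conf_desc cX ((φ.f (k + 1)).hom ≫ bY (k + 1)) (by
        dsimp
        rw [← cancel_epi (bX k), ← assoc, ← dX, ← assoc, ← hφ, assoc, dY, assoc, wY]
        simp)
      dsimp at hg
      refine ⟨g, fun _ => ⟨hg, ?_⟩⟩
      rw [← cancel_epi (bX (k + 1)), ← assoc, ← (hX _ hj).1, ← hφ, (hY _ hj).1, reassoc_of% hg]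
    · exact ⟨0, fun h => (hj h).elim⟩
  choose g hg using hg
  have hC : ∀ j, ∃ (C : F) (p : C ⟶ A (j + 1)) (q : C ⟶ (Y.X (j + 1)).obj), j < m →
      IsPullback p q (g (j + 1)) (bY (j + 1)) := by
    intro j
    by_cases hj : j < m
    · obtain ⟨C, q, p, sq, -⟩ := E.pullback_deflation (bY (j + 1)) (g (j + 1))
        ⟨_, _, _, (hY j hj).2.choose_spec⟩
      exact ⟨C, p, q, fun _ => sq.flip⟩
    · exact ⟨A (j + 1), 𝟙 _, 0, fun h => (hj h).elim⟩
  choose C p q sq using hC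
  let S := CochainComplex.mappingCone φ
  let inl (i : ℤ) : (X.X (i + 1)).obj ⟶ (S.X i).obj :=
    ((CochainComplex.mappingCone.inl φ).v (i + 1) i (by lia)).hom
  let inr (i : ℤ) : (Y.X i).obj ⟶ (S.X i).obj := ((CochainComplex.mappingCone.inr φ).f i).hom
  let fst (i : ℤ) : (S.X i).obj ⟶ (X.X (i + 1)).obj :=
    ((CochainComplex.mappingCone.fst φ).1.v i (i + 1) rfl).hom
  let snd (i : ℤ) : (S.X i).obj ⟶ (Y.X i).obj :=
    ((CochainComplex.mappingCone.snd φ).v i i (add_zero i)).hom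
  have h₁ : ∀ i, inl i ≫ fst i = 𝟙 _ := fun i =>
    E.projInj.ι.congr_map (CochainComplex.mappingCone.inl_v_fst_v φ (i + 1) i (by lia))
  have h₂ : ∀ i, inr i ≫ snd i = 𝟙 _ := fun i =>
    E.projInj.ι.congr_map (CochainComplex.mappingCone.inr_f_snd_v φ i)
  have h₃ : ∀ i, inl i ≫ snd i = 0 := fun i =>
    E.projInj.ι.congr_map (CochainComplex.mappingCone.inl_v_snd_v φ (i + 1) i (by lia))
  have h₄ : ∀ i, inr i ≫ fst i = 0 := fun i =>
    E.projInj.ι.congr_map (CochainComplex.mappingCone.inr_f_fst_v φ i (i + 1) rfl)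
  have h₅ : ∀ i, fst i ≫ inl i + snd i ≫ inr i = 𝟙 _ := fun i =>
    (E.projInj.ι.congr_map (CochainComplex.mappingCone.id_X φ i (i + 1) rfl))
  have h₆ : ∀ i, (S.d i (i + 1)).hom ≫ fst (i + 1) =
      -(fst i ≫ (X.d (i + 1) (i + 1 + 1)).hom) := fun i =>
    (E.projInj.ι.congr_map
      (CochainComplex.mappingCone.d_fst_v φ i (i + 1) (i + 1 + 1) rfl rfl))
  have h₇ : ∀ i, (S.d i (i + 1)).hom ≫ snd (i + 1) =
      fst i ≫ (φ.f (i + 1)).hom + snd i ≫ (Y.d i (i + 1)).hom := fun i =>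
    (E.projInj.ι.congr_map
      (CochainComplex.mappingCone.d_snd_v φ i (i + 1) rfl))
  have hβ : ∀ j, ∃ β : (S.X j).obj ⟶ C j, j < m - 1 → β ≫ p j = fst j ≫ bX (j + 1) ∧
      β ≫ q j = fst j ≫ (φ.f (j + 1)).hom + snd j ≫ bY j ≫ aY j := by
    intro j
    by_cases hj : j < m - 1
    · obtain ⟨-, wY, cY⟩ := hY j (by lia)
      have hs := sq j (by lia)
      refine ⟨hs.lift (fst j ≫ bX (j + 1))
        (fst j ≫ (φ.f (j + 1)).hom + snd j ≫ bY j ≫ aY j) ?_, fun _ => ⟨hs.lift_fst _ _ _, hs.lift_snd _ _ _⟩⟩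
      simp [(hg (j + 1) (by lia)).1, wY]
    · exact ⟨0, fun h => (hj h).elim⟩
  choose β hβ using hβ
  refine ⟨C, fun i => -(p i ≫ aX (i + 1) ≫ inl (i + 1)) + q i ≫ inr (i + 1), β,
    fun i hi => ⟨?_, ?_⟩⟩
  · change (S.d i (i + 1)).hom = _
    rw [← comp_id (S.d i (i + 1)).hom, ← h₅ (i + 1), Preadditive.comp_add,
      ← assoc, ← assoc, h₆, h₇, (hX (i + 1) (by lia)).1, (hY i (by lia)).1, Preadditive.comp_add,
      Preadditive.comp_neg, reassoc_of% (hβ i (by lia)).1, reassoc_of% (hβ i (by lia)).2]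
    simp
  · obtain ⟨dX, wX, cX⟩ := hX (i + 1) (by lia)
    obtain ⟨dY, wY, cY⟩ := hY (i + 1) (by lia)
    obtain ⟨dY', wY', cY'⟩ := hY i (by lia)
    exact conf_cone (aX (i + 1)) (bX (i + 1 + 1)) wX cX (bY (i + 1)) ⟨_, _, _, cY'⟩
      (aY (i + 1)) (bY (i + 1 + 1)) wY cY (φ.f (i + 1 + 1)).hom (g (i + 1)) (g (i + 1 + 1))
      (hg (i + 1) (by lia)).2 (hg (i + 1 + 1) (by lia)).1 (p i) (q i) (sq i (by lia))
      (p (i + 1)) (q (i + 1)) (sq (i + 1) (by lia)) (inl (i + 1)) (inr (i + 1)) (fst (i + 1))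
      (snd (i + 1)) (h₁ _) (h₂ _) (h₃ _) (h₄ _) (h₅ _) _ (by simp [h₁, h₄]) (by simp [h₂, h₃])
      (β (i + 1)) (hβ _ (by lia)).1 (hβ _ (by lia)).2

end Complexes
end ExactStructure

namespace ExactStructure

section Triangulated

lemma isTriangulated_map_quotient {C : Type u} [Category.{v} C] [Preadditive C]
    [HasZeroObject C] [HasBinaryBiproducts C] (S : ObjectProperty (CochainComplex C ℤ))
    (hzero : ∃ Z, IsZero Z ∧ S Z) (hshift : ∀ X (n : ℤ), S X → S (X⟦n⟧))
    (hcone : ∀ {X Y : CochainComplex C ℤ} (φ : X ⟶ Y), S X → S Y →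
      S (CochainComplex.mappingCone φ)) :
    (S.map (HomotopyCategory.quotient C (ComplexShape.up ℤ))).IsTriangulated := by
  let P := S.map (HomotopyCategory.quotient C (ComplexShape.up ℤ))
  have h₁ : P.ContainsZero := by
    obtain ⟨Z, hZ, hS⟩ := hzero
    exact ⟨_, Functor.map_isZero (HomotopyCategory.quotient C (ComplexShape.up ℤ)) hZ,
      _, hS, ⟨Iso.refl _⟩⟩
  have h₂ : P.IsStableUnderShift ℤ :=
    ⟨fun n => ⟨by
      rintro K ⟨X, hX, ⟨e⟩⟩
      exact ⟨X⟦n⟧, hshift _ _ hX,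
        ⟨((HomotopyCategory.quotient C (ComplexShape.up ℤ)).commShiftIso n).app X ≪≫
          (shiftFunctor _ n).mapIso e⟩⟩⟩⟩
  have h₃ : P.IsTriangulatedClosed₃ := by
    refine ObjectProperty.IsTriangulatedClosed₃.mk' ?_
    rintro T hT ⟨X, hX, ⟨e⟩⟩ ⟨Y, hY, ⟨e'⟩⟩
    obtain ⟨f, hf⟩ := (HomotopyCategory.quotient C (ComplexShape.up ℤ)).map_surjective
      (e.hom ≫ T.mor₁ ≫ e'.inv)
    refine ⟨_, hcone f hX hY, ⟨Triangle.π₃.mapIso (isoTriangleOfIso₁₂ _ T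
      (HomotopyCategory.mappingCone_triangleh_distinguished f) hT e e' ?_)⟩⟩
    change (HomotopyCategory.quotient C (ComplexShape.up ℤ)).map f ≫ _ = _
    rw [hf]
    simp only [assoc, Iso.inv_hom_id, comp_id]
    rfl
  have h₄ : P.IsTriangulatedClosed₂ := .of_isTriangulatedClosed₃
  exact { }

variable {F : Type u} [Category.{v} F] [Preadditive F] [HasZeroObject F] [HasBinaryBiproducts F]
  (E : ExactStructure F)

variable {E}

open ZeroObject in
lemma conf_of_isZero {A B C : F} (i : A ⟶ B) (p : B ⟶ C) (hA : IsZero A) (hB : IsZero B)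
    (hC : IsZero C) : E.conf (ShortComplex.mk i p (hA.eq_of_src _ _)) := by
  obtain ⟨X, f, w, hc⟩ := E.id_deflation (0 : F)
  have := E.iso_closed
  have : Mono f := conf_mono hc
  have hX : IsZero X := by
    rw [IsZero.iff_id_eq_zero, ← cancel_mono f]
    exact (isZero_zero F).eq_of_tgt _ _
  exact E.conf.prop_of_iso (ShortComplex.isoMk
    (S₁ := ShortComplex.mk _ _ w) (S₂ := ShortComplex.mk i p (hA.eq_of_src _ _))
    (hX.iso hA) ((isZero_zero F).iso hB) ((isZero_zero F).iso hC)
    (hX.eq_of_src _ _) ((isZero_zero F).eq_of_src _ _)) hc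

lemma ConflationsUpTo.shift {X : CochainComplex E.ProjInj ℤ} {m : ℤ}
    (h : E.ConflationsUpTo X m) (n : ℤ) : E.ConflationsUpTo (X⟦n⟧) (m - n) := by
  obtain ⟨Y, a, b, h⟩ := h
  have := E.iso_closed
  refine ⟨fun i => Y (i + n), fun i => n.negOnePow • (a (i + n) ≫
    (HomologicalComplex.XIsoOfEq X (show i + n + 1 = i + 1 + n by lia)).hom.hom),
    fun i => b (i + n), fun i hi => ⟨?_, ?_⟩⟩
  · have aux : ∀ k (hk : i + n + 1 = k), (X.d (i + n) k).hom =
        b (i + n) ≫ a (i + n) ≫ (HomologicalComplex.XIsoOfEq X hk).hom.hom := by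
      rintro k rfl
      simp [(h (i + n) (by lia)).1]
    have hd : (X⟦n⟧.d i (i + 1)).hom = n.negOnePow • (X.d (i + n) (i + 1 + n)).hom := rfl
    refine hd.trans ?_
    rw [aux _ (show i + n + 1 = i + 1 + n by lia)]
    exact (Linear.comp_units_smul _ _ _).symm
  · have aux : ∀ k (hk : i + n + 1 = k), ∃ w : (n.negOnePow • (a (i + n) ≫
        (HomologicalComplex.XIsoOfEq X hk).hom.hom)) ≫ b k = 0,
        E.conf (ShortComplex.mk (n.negOnePow • (a (i + n) ≫
        (HomologicalComplex.XIsoOfEq X hk).hom.hom)) (b k) w) := by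
      rintro k rfl
      obtain ⟨w, hc⟩ := (h (i + n) (by lia)).2
      refine ⟨by simp [Linear.units_smul_comp, w], E.conf.prop_of_iso (ShortComplex.isoMk
        (S₁ := ShortComplex.mk _ _ w) (S₂ := ShortComplex.mk _ _ _)
        (n.negOnePow • Iso.refl _) (Iso.refl _) (Iso.refl _) ?_ ?_) hc⟩
      · dsimp
        simp [smul_smul]
      · dsimp
        simp
    exact aux _ _

lemma isZero_mappingCone_X {X Y : CochainComplex E.ProjInj ℤ} (φ : X ⟶ Y) (i : ℤ)
    (hX : IsZero (X.X (i + 1))) (hY : IsZero (Y.X i)) :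
    IsZero ((CochainComplex.mappingCone φ).X i) := by
  rw [CochainComplex.mappingCone.isZero_X_iff]
  exact ⟨hX, hY⟩

open ZeroObject in
instance : (E.bounded.map (HomotopyCategory.quotient _ _)).IsTriangulated :=
  isTriangulated_map_quotient _
    ⟨0, isZero_zero _, ⟨0, fun i _ => (HomologicalComplex.eval _ _ i).map_isZero (isZero_zero _)⟩,
      ⟨0, fun i _ => (HomologicalComplex.eval _ _ i).map_isZero (isZero_zero _)⟩⟩
    (by
      rintro X n ⟨⟨p, hp⟩, ⟨q, hq⟩⟩
      exact ⟨⟨p - n, fun i hi => hp (i + n) (by lia)⟩, ⟨q - n, fun i hi => hq (i + n) (by lia)⟩⟩)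
    (by
      rintro X Y φ ⟨⟨p, hp⟩, ⟨q, hq⟩⟩ ⟨⟨p', hp'⟩, ⟨q', hq'⟩⟩
      exact ⟨⟨max p p', fun i hi => isZero_mappingCone_X φ i (hp _ (by lia)) (hp' _ (by lia))⟩,
        ⟨min q q' - 1, fun i hi => isZero_mappingCone_X φ i (hq _ (by lia)) (hq' _ (by lia))⟩⟩)

open ZeroObject in
instance : (E.minusB.map (HomotopyCategory.quotient _ _)).IsTriangulated :=
  isTriangulated_map_quotient _
    ⟨0, isZero_zero _, ⟨0, fun i _ => (HomologicalComplex.eval _ _ i).map_isZero (isZero_zero _)⟩,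
      ⟨0, fun _ => 0, fun _ => 0, fun _ => 0, fun i _ => by
        have h : ∀ i, IsZero ((0 : CochainComplex E.ProjInj ℤ).X i) := fun i =>
          (HomologicalComplex.eval _ _ i).map_isZero (isZero_zero _)
        refine ⟨?_, by simp, conf_of_isZero _ _ (isZero_zero _) ?_ (isZero_zero _)⟩
        · rw [(h i).eq_of_src (HomologicalComplex.d _ _ _) 0]
          simp
        · rw [IsZero.iff_id_eq_zero]
          exact E.projInj.ι.congr_map ((h (i + 1)).eq_of_src (𝟙 _) 0)⟩⟩
    (by
      rintro X n ⟨⟨p, hp⟩, ⟨q, hq⟩⟩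
      exact ⟨⟨p - n, fun i hi => hp (i + n) (by lia)⟩, ⟨q - n, hq.shift n⟩⟩)
    (by
      rintro X Y φ ⟨⟨p, hp⟩, ⟨q, hq⟩⟩ ⟨⟨p', hp'⟩, ⟨q', hq'⟩⟩
      exact ⟨⟨max p p', fun i hi => isZero_mappingCone_X φ i (hp _ (by lia)) (hp' _ (by lia))⟩,
        ⟨min q q' - 2, (hq.mono (min_le_left _ _)).mappingCone φ (hq'.mono (min_le_right _ _))⟩⟩)

variable (E)

/-- `K^{-,b}(P)`, as a property of objects of `K(P)` (closed under isomorphisms). -/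
abbrev KmbProp : ObjectProperty E.KP := E.minusB.map (HomotopyCategory.quotient _ _)

/-- `K^b(P)`, as a property of objects of `K(P)` (closed under isomorphisms). -/
abbrev KbProp : ObjectProperty E.KP := E.bounded.map (HomotopyCategory.quotient _ _)

/-- The triangulated category `K^{-,b}(P)`: a full triangulated subcategory of `K(P)`. -/
abbrev Kmb := E.KmbProp.FullSubcategory

/-- `K^b(P)` as a subcategory of `K^{-,b}(P)`. -/
abbrev Kb : ObjectProperty E.Kmb := E.KbProp.inverseImage E.KmbProp.ι

/-- `K^{>0}(P)` as a subcategory of `K^{-,b}(P)`: bounded complexes `X` with `X^i = 0`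
for `i ≤ 0`. -/
def Kpos : ObjectProperty E.Kmb :=
  ObjectProperty.inverseImage (ObjectProperty.map
    (fun X : CochainComplex E.ProjInj ℤ => E.bounded X ∧ ∀ i, i ≤ 0 → IsZero (X.X i))
    (HomotopyCategory.quotient _ _)) E.KmbProp.ι

/-- `K^{<0}(P)` as a subcategory of `K^{-,b}(P)`: bounded complexes `X` with `X^i = 0`
for `i ≥ 0`. -/
def Kneg : ObjectProperty E.Kmb :=
  ObjectProperty.inverseImage (ObjectProperty.map
    (fun X : CochainComplex E.ProjInj ℤ => E.bounded X ∧ ∀ i, 0 ≤ i → IsZero (X.X i))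
    (HomotopyCategory.quotient _ _)) E.KmbProp.ι

/-- The full subcategory of `K^{-,b}(P)` identified with `F`: objects isomorphic in `K(P)` to a
complex `X` with `X^i = 0` for `i > 0` and conflations in all degrees `i ≤ 0`. -/
def resolutions : ObjectProperty E.Kmb :=
  ObjectProperty.inverseImage (ObjectProperty.map
    (fun X : CochainComplex E.ProjInj ℤ =>
      (∀ i, 0 < i → IsZero (X.X i)) ∧ E.ConflationsUpTo X 0)
    (HomotopyCategory.quotient _ _)) E.KmbProp.ι

/-- The Verdier quotient `K^{-,b}(P)/K^b(P)`: the localization at the morphisms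
whose cone belongs to `K^b(P)`. -/
abbrev VerdierQuotient := E.Kb.trW.Localization

/-- The Verdier quotient functor. -/
abbrev toVerdierQuotient : E.Kmb ⥤ E.VerdierQuotient := E.Kb.trW.Q

end Triangulated

/-- The condition `Hom(P, Q) = 0` for full subcategories `P` and `Q`. -/
def HomVanish {C : Type*} [Category C] [HasZeroMorphisms C] (P Q : ObjectProperty C) : Prop :=
  ∀ ⦃X Y : C⦄ (f : X ⟶ Y), P X → Q Y → f = 0

end ExactStructure

namespace ExactStructure

section Stable

variable {F : Type u} [Category.{v} F] [Preadditive F] (E : ExactStructure F)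

/-- Two morphisms are identified in the stable category if their difference factors through
a projective-injective object. -/
def stableRel : HomRel F := fun X Y f g =>
  ∃ (Q : F) (a : X ⟶ Q) (b : Q ⟶ Y), E.projInj Q ∧ f - g = a ≫ b

/-- The stable category `F/[P]`. -/
abbrev Stable := CategoryTheory.Quotient E.stableRel

/-- The projection `F ⥤ F/[P]`. -/
abbrev toStable : F ⥤ E.Stable := CategoryTheory.Quotient.functor E.stableRel

variable [E.IsFrobenius]

lemma exists_hull (A : F) : ∃ (I C : F) (i : A ⟶ I) (p : I ⟶ C) (w : i ≫ p = 0),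
    E.projInj I ∧ E.conf (ShortComplex.mk i p w) := by
  obtain ⟨I, i, hI, C, p, w, hc⟩ := IsFrobenius.enough_inj (E := E) A
  exact ⟨I, C, i, p, w, ⟨(IsFrobenius.proj_iff_inj (E := E) I).2 hI, hI⟩, hc⟩

/-- The middle term `I(A)` of a chosen conflation `A ⟶ I(A) ⟶ ΣA` with `I(A)` injective. -/
noncomputable def hull (A : F) : F := (E.exists_hull A).choose

/-- The last term `ΣA` of the chosen conflation `A ⟶ I(A) ⟶ ΣA`. -/
noncomputable def cosyz (A : F) : F := (E.exists_hull A).choose_spec.choose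

noncomputable def hullι (A : F) : A ⟶ E.hull A := (E.exists_hull A).choose_spec.choose_spec.choose

noncomputable def hullπ (A : F) : E.hull A ⟶ E.cosyz A :=
  (E.exists_hull A).choose_spec.choose_spec.choose_spec.choose

lemma hull_w (A : F) : E.hullι A ≫ E.hullπ A = 0 :=
  (E.exists_hull A).choose_spec.choose_spec.choose_spec.choose_spec.choose

lemma hull_projInj (A : F) : E.projInj (E.hull A) :=
  (E.exists_hull A).choose_spec.choose_spec.choose_spec.choose_spec.choose_spec.1

lemma hull_conf (A : F) : E.conf (ShortComplex.mk _ _ (E.hull_w A)) :=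
  (E.exists_hull A).choose_spec.choose_spec.choose_spec.choose_spec.choose_spec.2

/-- A morphism `s : ΣA ⟶ ΣB` induced by `f : A ⟶ B`. -/
def IsSuspMap {A B : F} (f : A ⟶ B) (s : E.cosyz A ⟶ E.cosyz B) : Prop :=
  ∃ k : E.hull A ⟶ E.hull B, E.hullι A ≫ k = f ≫ E.hullι B ∧ E.hullπ A ≫ s = k ≫ E.hullπ B

lemma exists_suspMap {A B : F} (f : A ⟶ B) : ∃ s, E.IsSuspMap f s := by
  obtain ⟨k, hk⟩ := (E.hull_projInj B).2 (E.hullι A) ⟨_, _, _, E.hull_conf A⟩ (f ≫ E.hullι B)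
  obtain ⟨s, hs⟩ := conf_desc (E.hull_conf A) (k ≫ E.hullπ B) (by
    dsimp; rw [← assoc, hk, assoc, hull_w, comp_zero])
  exact ⟨s, k, hk, hs⟩

lemma IsSuspMap.congr {A B : F} {f f' : A ⟶ B} {s s' : E.cosyz A ⟶ E.cosyz B}
    (h : E.IsSuspMap f s) (h' : E.IsSuspMap f' s') (hf : E.stableRel f f') :
    E.stableRel s s' := by
  obtain ⟨k, hk, hs⟩ := h
  obtain ⟨k', hk', hs'⟩ := h'
  obtain ⟨Q, a, b, hQ, hab⟩ := hf
  obtain ⟨a', ha'⟩ := hQ.2 (E.hullι A) ⟨_, _, _, E.hull_conf A⟩ a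
  obtain ⟨l, hl⟩ := conf_desc (E.hull_conf A) (k - k' - a' ≫ b ≫ E.hullι B) (by
    dsimp
    rw [Preadditive.comp_sub, Preadditive.comp_sub, hk, hk', reassoc_of% ha', ← reassoc_of% hab,
      Preadditive.sub_comp, sub_self])
  refine ⟨E.hull B, l, E.hullπ B, E.hull_projInj B, ?_⟩
  have : Epi (E.hullπ A) := conf_epi (E.hull_conf A)
  dsimp at hl
  rw [← cancel_epi (E.hullπ A), Preadditive.comp_sub, hs, hs', reassoc_of% hl]
  simp [hull_w]

/-- Happel's suspension functor on the stable category, sending `A` to `ΣA`. -/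
noncomputable def susp : E.Stable ⥤ E.Stable :=
  CategoryTheory.Quotient.lift E.stableRel
    { obj := fun A => E.toStable.obj (E.cosyz A)
      map := fun f => E.toStable.map (E.exists_suspMap f).choose
      map_id := fun A => by
        refine Eq.trans ?_ (E.toStable.map_id _)
        exact CategoryTheory.Quotient.sound _ (IsSuspMap.congr E (E.exists_suspMap (𝟙 A)).choose_spec
          (f' := 𝟙 A) ⟨𝟙 _, by simp, by simp⟩ ⟨E.hull A, 0, 0, E.hull_projInj A, by simp⟩)
      map_comp := fun {A B C} f g => by
        rw [← E.toStable.map_comp]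
        obtain ⟨k, hk, hs⟩ := (E.exists_suspMap f).choose_spec
        obtain ⟨k', hk', hs'⟩ := (E.exists_suspMap g).choose_spec
        exact CategoryTheory.Quotient.sound _ (IsSuspMap.congr E
          (E.exists_suspMap (f ≫ g)).choose_spec
          ⟨k ≫ k', by rw [reassoc_of% hk, hk', assoc], by rw [reassoc_of% hs, hs', assoc]⟩
          ⟨E.hull A, 0, 0, E.hull_projInj A, by simp⟩) }
    (fun A B f f' h => CategoryTheory.Quotient.sound _
      (IsSuspMap.congr E (E.exists_suspMap f).choose_spec (E.exists_suspMap f').choose_spec h))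

/-- Happel's distinguished triangles in the stable category: the diagrams isomorphic to
`A ⟶ B ⟶ C ⟶ ΣA`, where `C` is the pushout of `u : A ⟶ B` and `A ⟶ I(A)`, and `C ⟶ ΣA` is
induced by `0 : B ⟶ ΣA` and by the projection `I(A) ⟶ ΣA`. -/
def IsHappelTriangle {X Y Z : E.Stable} (f : X ⟶ Y) (g : Y ⟶ Z) (h : Z ⟶ E.susp.obj X) : Prop :=
  ∃ (A B C : F) (u : A ⟶ B) (v : B ⟶ C) (x : E.hull A ⟶ C) (w : C ⟶ E.cosyz A)
    (e₁ : X ≅ E.toStable.obj A) (e₂ : Y ≅ E.toStable.obj B) (e₃ : Z ≅ E.toStable.obj C),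
    IsPushout u (E.hullι A) v x ∧ v ≫ w = 0 ∧ x ≫ w = E.hullπ A ∧
    f ≫ e₂.hom = e₁.hom ≫ E.toStable.map u ∧
    g ≫ e₃.hom = e₂.hom ≫ E.toStable.map v ∧
    h ≫ E.susp.map e₁.hom = e₃.hom ≫ E.toStable.map w

end Stable
end ExactStructure

namespace ExactStructure

section Resolution

variable {F : Type u} [Category.{v} F] [Preadditive F] (E : ExactStructure F) [E.IsFrobenius]

lemma exists_cover (A : F) : ∃ (P : E.ProjInj) (K : F) (i : K ⟶ P.obj) (p : P.obj ⟶ A)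
    (w : i ≫ p = 0), E.conf (ShortComplex.mk i p w) := by
  obtain ⟨P, p, hP, K, i, w, hc⟩ := IsFrobenius.enough_proj (E := E) A
  exact ⟨⟨P, hP, (IsFrobenius.proj_iff_inj (E := E) P).1 hP⟩, K, i, p, w, hc⟩

/-- The middle term `P(A)` of a chosen conflation `ΩA ⟶ P(A) ⟶ A` with `P(A)` projective. -/
noncomputable def cover (A : F) : E.ProjInj := (E.exists_cover A).choose

/-- The first term `ΩA` of the chosen conflation `ΩA ⟶ P(A) ⟶ A`. -/
noncomputable def syz (A : F) : F := (E.exists_cover A).choose_spec.choose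

noncomputable def coverι (A : F) : E.syz A ⟶ (E.cover A).obj :=
  (E.exists_cover A).choose_spec.choose_spec.choose

noncomputable def coverπ (A : F) : (E.cover A).obj ⟶ A :=
  (E.exists_cover A).choose_spec.choose_spec.choose_spec.choose

lemma cover_w (A : F) : E.coverι A ≫ E.coverπ A = 0 :=
  (E.exists_cover A).choose_spec.choose_spec.choose_spec.choose_spec.choose

lemma cover_conf (A : F) : E.conf (ShortComplex.mk _ _ (E.cover_w A)) :=
  (E.exists_cover A).choose_spec.choose_spec.choose_spec.choose_spec.choose_spec

lemma exists_coverMap {A B : F} (f : A ⟶ B) :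
    ∃ (k : E.cover A ⟶ E.cover B) (s : E.syz A ⟶ E.syz B),
      k.hom ≫ E.coverπ B = E.coverπ A ≫ f ∧ s ≫ E.coverι B = E.coverι A ≫ k.hom := by
  obtain ⟨k, hk⟩ := (E.cover A).property.1 (E.coverπ B) ⟨_, _, _, E.cover_conf B⟩
    (E.coverπ A ≫ f)
  obtain ⟨s, hs⟩ := conf_lift (E.cover_conf B) (E.coverι A ≫ k) (by
    dsimp; rw [assoc, hk, ← assoc, cover_w, zero_comp])
  exact ⟨ObjectProperty.homMk k, s, hk, hs⟩

noncomputable def coverMap {A B : F} (f : A ⟶ B) : E.cover A ⟶ E.cover B :=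
  (E.exists_coverMap f).choose

noncomputable def syzMap {A B : F} (f : A ⟶ B) : E.syz A ⟶ E.syz B :=
  (E.exists_coverMap f).choose_spec.choose

lemma coverMap_π {A B : F} (f : A ⟶ B) :
    (E.coverMap f).hom ≫ E.coverπ B = E.coverπ A ≫ f :=
  (E.exists_coverMap f).choose_spec.choose_spec.1

lemma syzMap_ι {A B : F} (f : A ⟶ B) :
    E.syzMap f ≫ E.coverι B = E.coverι A ≫ (E.coverMap f).hom :=
  (E.exists_coverMap f).choose_spec.choose_spec.2

/-- The iterated syzygy `Ω^n A`. -/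
noncomputable def iterSyz (A : F) : ℕ → F
  | 0 => A
  | n + 1 => E.syz (iterSyz A n)

noncomputable def iterSyzMap {A B : F} (f : A ⟶ B) : ∀ n, E.iterSyz A n ⟶ E.iterSyz B n
  | 0 => f
  | n + 1 => E.syzMap (iterSyzMap f n)

/-- The term `P(Ω^n A)` of the resolution of `A`. -/
noncomputable def resObj (A : F) (n : ℕ) : E.ProjInj := E.cover (E.iterSyz A n)

noncomputable def resι (A : F) (n : ℕ) : E.iterSyz A (n + 1) ⟶ (E.resObj A n).obj :=
  E.coverι (E.iterSyz A n)

noncomputable def resπ (A : F) (n : ℕ) : (E.resObj A n).obj ⟶ E.iterSyz A n :=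
  E.coverπ (E.iterSyz A n)

lemma res_w (A : F) (n : ℕ) : E.resι A n ≫ E.resπ A n = 0 := E.cover_w _

lemma res_conf (A : F) (n : ℕ) : E.conf (ShortComplex.mk _ _ (E.res_w A n)) := E.cover_conf _

noncomputable def resObjMap {A B : F} (f : A ⟶ B) (n : ℕ) : E.resObj A n ⟶ E.resObj B n :=
  E.coverMap (E.iterSyzMap f n)

lemma resObjMap_π {A B : F} (f : A ⟶ B) (n : ℕ) :
    (E.resObjMap f n).hom ≫ E.resπ B n = E.resπ A n ≫ E.iterSyzMap f n := E.coverMap_π _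

lemma resObjMap_ι {A B : F} (f : A ⟶ B) (n : ℕ) :
    E.iterSyzMap f (n + 1) ≫ E.resι B n = E.resι A n ≫ (E.resObjMap f n).hom := E.syzMap_ι _

/-- The projective resolution `⋯ ⟶ P(Ω²A) ⟶ P(ΩA) ⟶ P(A)` of `A`. -/
noncomputable abbrev resChain (A : F) : ChainComplex E.ProjInj ℕ :=
  ChainComplex.of (fun n => E.resObj A n)
    (fun n => ObjectProperty.homMk (E.resπ A (n + 1) ≫ E.resι A n))
    (fun n => by
      apply ObjectProperty.hom_ext
      change (_ ≫ _) ≫ (_ ≫ _) = 0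
      simp only [assoc]
      rw [reassoc_of% (E.res_w A (n + 1))]
      simp)

lemma resChain_d (A : F) (n : ℕ) : ((E.resChain A).d (n + 1) n) =
    ObjectProperty.homMk (E.resπ A (n + 1) ≫ E.resι A n) :=
  ChainComplex.of_d (fun n => E.resObj A n)
    (fun n => ObjectProperty.homMk (E.resπ A (n + 1) ≫ E.resι A n)) n

/-- The chain map between projective resolutions induced by `f`. -/
noncomputable def resMap {A B : F} (f : A ⟶ B) : E.resChain A ⟶ E.resChain B :=
  ChainComplex.ofHom (fun n => E.resObjMap f n) (fun n => by
    rw [resChain_d, resChain_d]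
    apply ObjectProperty.hom_ext
    change (E.resObjMap f (n + 1)).hom ≫ E.resπ B (n + 1) ≫ E.resι B n =
      (E.resπ A (n + 1) ≫ E.resι A n) ≫ (E.resObjMap f n).hom
    rw [assoc, ← resObjMap_ι, ← assoc, resObjMap_π, assoc])

lemma exists_lift_zero {Q B : F} (hQ : E.projInj Q) (h : Q ⟶ (E.resObj B 0).obj)
    (w : h ≫ E.resπ B 0 = 0) :
    ∃ l : Q ⟶ (E.resObj B 1).obj, l ≫ E.resπ B 1 ≫ E.resι B 0 = h := by
  obtain ⟨k, hk⟩ := conf_lift (E.res_conf B 0) h w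
  obtain ⟨l, hl⟩ := hQ.1 (E.resπ B 1) ⟨_, _, _, E.res_conf B 1⟩ k
  exact ⟨l, by rw [← assoc, hl]; exact hk⟩

lemma exists_lift_succ {Q B : F} (hQ : E.projInj Q) (n : ℕ) (h : Q ⟶ (E.resObj B (n + 1)).obj)
    (w : h ≫ E.resπ B (n + 1) ≫ E.resι B n = 0) :
    ∃ l : Q ⟶ (E.resObj B (n + 2)).obj, l ≫ E.resπ B (n + 2) ≫ E.resι B (n + 1) = h := by
  have : Mono (E.resι B n) := conf_mono (E.res_conf _ _)
  obtain ⟨k, hk⟩ := conf_lift (E.res_conf B (n + 1)) h (by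
    dsimp
    rw [← cancel_mono (E.resι B n), zero_comp, assoc, w])
  obtain ⟨l, hl⟩ := hQ.1 (E.resπ B (n + 2)) ⟨_, _, _, E.res_conf B (n + 2)⟩ k
  exact ⟨l, by rw [← assoc, hl]; exact hk⟩

lemma exists_lift_zero' (Q : E.ProjInj) (B : F) (h : Q ⟶ (E.resChain B).X 0)
    (w : h.hom ≫ E.resπ B 0 = 0) :
    ∃ l : Q ⟶ (E.resChain B).X 1, l ≫ (E.resChain B).d 1 0 = h := by
  obtain ⟨l, hl⟩ := E.exists_lift_zero Q.property h.hom w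
  refine ⟨ObjectProperty.homMk l, ?_⟩
  rw [E.resChain_d B 0]
  exact ObjectProperty.hom_ext _ hl

lemma exists_lift_succ' (Q : E.ProjInj) (B : F) (n : ℕ) (h : Q ⟶ (E.resChain B).X (n + 1))
    (w : h ≫ (E.resChain B).d (n + 1) n = 0) :
    ∃ l : Q ⟶ (E.resChain B).X (n + 2), l ≫ (E.resChain B).d (n + 2) (n + 1) = h := by
  rw [resChain_d] at w
  obtain ⟨l, hl⟩ := E.exists_lift_succ Q.property n h.hom (E.projInj.ι.congr_map w)
  refine ⟨ObjectProperty.homMk l, ?_⟩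
  rw [E.resChain_d B (n + 1)]
  exact ObjectProperty.hom_ext _ hl

lemma nonempty_homotopy_zero {A B : F} (g : E.resChain A ⟶ E.resChain B)
    (hg : (g.f 0).hom ≫ E.resπ B 0 = 0) : Nonempty (Homotopy g 0) := by
  obtain ⟨z, hz⟩ := E.exists_lift_zero' _ B (g.f 0) hg
  obtain ⟨o, ho⟩ := E.exists_lift_succ' _ B 0 (g.f 1 - (E.resChain A).d 1 0 ≫ z) (by
    rw [Preadditive.sub_comp, assoc, hz, g.comm, sub_self])
  have succ : ∀ (n : ℕ) (p : Σ' (f : (E.resChain A).X n ⟶ (E.resChain B).X (n + 1))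
      (f' : (E.resChain A).X (n + 1) ⟶ (E.resChain B).X (n + 2)),
        g.f (n + 1) = (E.resChain A).d (n + 1) n ≫ f + f' ≫ (E.resChain B).d (n + 2) (n + 1)),
      ∃ f'' : (E.resChain A).X (n + 2) ⟶ (E.resChain B).X (n + 3),
        g.f (n + 2) = (E.resChain A).d (n + 2) (n + 1) ≫ p.2.1 +
          f'' ≫ (E.resChain B).d (n + 3) (n + 2) := by
    rintro n ⟨f, f', hf⟩
    obtain ⟨l, hl⟩ := E.exists_lift_succ' _ B (n + 1)
      (g.f (n + 2) - (E.resChain A).d (n + 2) (n + 1) ≫ f') (by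
        rw [Preadditive.sub_comp, assoc, g.comm, hf, Preadditive.comp_add,
          HomologicalComplex.d_comp_d_assoc, zero_comp, zero_add, sub_self])
    exact ⟨l, by rw [hl, add_sub_cancel]⟩
  exact ⟨Homotopy.mkInductive g z hz.symm o (by rw [ho, add_sub_cancel])
    (fun n p => ⟨(succ n p).choose, (succ n p).choose_spec⟩)⟩

lemma quotient_map_eq {A B : F} (g g' : E.resChain A ⟶ E.resChain B)
    (hg : (g.f 0).hom ≫ E.resπ B 0 = (g'.f 0).hom ≫ E.resπ B 0) :
    (HomotopyCategory.quotient _ _).map g = (HomotopyCategory.quotient _ _).map g' := by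
  obtain ⟨h⟩ := E.nonempty_homotopy_zero (g - g')
    ((Preadditive.sub_comp (g.f 0).hom (g'.f 0).hom (E.resπ B 0)).trans
      (sub_eq_zero.2 hg))
  exact HomotopyCategory.eq_of_homotopy _ _ (Homotopy.equivSubZero.symm h)

lemma resMap_π {A B : F} (f : A ⟶ B) :
    ((E.resMap f).f 0).hom ≫ E.resπ B 0 = E.resπ A 0 ≫ f :=
  E.resObjMap_π f 0

/-- The functor sending `A` to a projective resolution, as a chain complex up to homotopy. -/
noncomputable def resFunctor : F ⥤ HomotopyCategory E.ProjInj (ComplexShape.down ℕ) where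
  obj A := (HomotopyCategory.quotient _ _).obj (E.resChain A)
  map f := (HomotopyCategory.quotient _ _).map (E.resMap f)
  map_id A := (E.quotient_map_eq _ (𝟙 _)
    ((E.resMap_π (𝟙 A)).trans ((comp_id (E.resπ A 0)).trans
      (id_comp (E.resπ A 0)).symm))).trans ((HomotopyCategory.quotient _ _).map_id _)
  map_comp {A B C} f g := (E.quotient_map_eq _ (E.resMap f ≫ E.resMap g) (by
      rw [resMap_π]
      have h₁ := E.resMap_π f
      have h₂ := E.resMap_π g
      change _ = ((E.resObjMap f 0).hom ≫ (E.resObjMap g 0).hom) ≫ E.resπ C 0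
      change (E.resObjMap f 0).hom ≫ E.resπ B 0 = E.resπ A 0 ≫ f at h₁
      change (E.resObjMap g 0).hom ≫ E.resπ C 0 = E.resπ B 0 ≫ g at h₂
      exact ((assoc (E.resObjMap f 0).hom (E.resObjMap g 0).hom (E.resπ C 0)).trans
        ((congrArg ((E.resObjMap f 0).hom ≫ ·) h₂).trans
          ((assoc (E.resObjMap f 0).hom (E.resπ B 0) g).symm.trans
            ((congrArg (· ≫ g) h₁).trans (assoc (E.resπ A 0) f g))))).symm)).trans
    ((HomotopyCategory.quotient _ _).map_comp _ _)

variable [HasZeroObject F] [HasBinaryBiproducts F]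

/-- The projective resolution of `A` as a cochain complex concentrated in degrees `≤ 0`. -/
noncomputable abbrev resCochain (A : F) : CochainComplex E.ProjInj ℤ :=
  (E.resChain A).extend ComplexShape.embeddingDownNat

lemma isZero_resCochain_X (A : F) (i : ℤ) (hi : 0 < i) : IsZero ((E.resCochain A).X i) :=
  HomologicalComplex.isZero_extend_X _ _ _ (fun n => by
    change -(n : ℤ) ≠ i
    lia)

/-- The identification of the term of degree `-n` of `resCochain`. -/
noncomputable def resCochainXIso (A : F) (n : ℕ) (i : ℤ) (h : -(n : ℤ) = i) :
    ((E.resCochain A).X i).obj ≅ (E.resObj A n).obj :=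
  E.projInj.ι.mapIso ((E.resChain A).extendXIso ComplexShape.embeddingDownNat h)

lemma resCochain_d (A : F) (n : ℕ) (i j : ℤ) (h : -((n + 1 : ℕ) : ℤ) = i) (h' : -(n : ℤ) = j) :
    ((E.resCochain A).d i j).hom = (E.resCochainXIso A (n + 1) i h).hom ≫
      (E.resπ A (n + 1) ≫ E.resι A n) ≫ (E.resCochainXIso A n j h').inv := by
  have := (E.resChain A).extend_d_eq ComplexShape.embeddingDownNat (i := n + 1) (j := n) h h'
  rw [resChain_d] at this
  exact E.projInj.ι.congr_map this

lemma conflationsUpTo_resCochain (A : F) : E.ConflationsUpTo (E.resCochain A) 0 := by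
  have := E.iso_closed
  have ha : ∀ i, ∃ a : E.iterSyz A (-i).toNat ⟶ ((E.resCochain A).X (i + 1)).obj, ∀ (n : ℕ)
      (h : -((n + 1 : ℕ) : ℤ) = i) (h₀ : -(n : ℤ) = i + 1)
      (h' : E.iterSyz A (n + 1) = E.iterSyz A (-i).toNat), a = eqToHom h'.symm ≫
        E.resι A n ≫ (E.resCochainXIso A n (i + 1) h₀).inv := by
    intro i
    by_cases hi : ∃ n : ℕ, -((n + 1 : ℕ) : ℤ) = i
    · obtain ⟨n, hn⟩ := hi
      refine ⟨eqToHom (congrArg (E.iterSyz A) (by omega)) ≫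
        E.resι A n ≫ (E.resCochainXIso A n (i + 1) (by omega)).inv, ?_⟩
      intro n' h _ h'
      obtain rfl : n = n' := by omega
      rfl
    · exact ⟨0, fun n h _ _ => (hi ⟨n, h⟩).elim⟩
  have hb : ∀ i, ∃ b : ((E.resCochain A).X i).obj ⟶ E.iterSyz A (-i).toNat, ∀ (n : ℕ)
      (h : -(n : ℤ) = i) (h' : E.iterSyz A n = E.iterSyz A (-i).toNat), b =
        (E.resCochainXIso A n i h).hom ≫ E.resπ A n ≫ eqToHom h' := by
    intro i
    by_cases hi : ∃ n : ℕ, -(n : ℤ) = i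
    · obtain ⟨n, hn⟩ := hi
      refine ⟨(E.resCochainXIso A n i hn).hom ≫ E.resπ A n ≫
        eqToHom (congrArg (E.iterSyz A) (by omega)), ?_⟩
      intro n' h h'
      obtain rfl : n = n' := by omega
      rfl
    · exact ⟨0, fun n h _ => (hi ⟨n, h⟩).elim⟩
  choose a ha using ha
  choose b hb using hb
  refine ⟨fun i => E.iterSyz A (-i).toNat, a, b, fun i hi => ?_⟩
  obtain ⟨n, hn⟩ : ∃ n : ℕ, -((n + 1 : ℕ) : ℤ) = i := ⟨(-i).toNat - 1, by omega⟩
  have h₀ : -(n : ℤ) = i + 1 := by omega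
  have e₁ : E.iterSyz A (n + 1) = E.iterSyz A (-i).toNat := congrArg (E.iterSyz A) (by omega)
  have e₂ : E.iterSyz A n = E.iterSyz A (-(i + 1)).toNat := congrArg (E.iterSyz A) (by omega)
  have ha' := ha i n hn h₀ e₁
  have hb₁ := hb i (n + 1) hn e₁
  have hb₂ := hb (i + 1) n h₀ e₂
  have hw : a i ≫ b (i + 1) = 0 := by
    rw [ha', hb₂]
    simp only [assoc, Iso.inv_hom_id_assoc]
    rw [reassoc_of% (E.res_w A n)]
    simp
  refine ⟨?_, hw, ?_⟩
  · refine (E.resCochain_d A n i (i + 1) hn h₀).trans ?_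
    rw [ha', hb₁]
    simp
  · refine E.conf.prop_of_iso (ShortComplex.isoMk
      (S₁ := ShortComplex.mk _ _ (E.res_w A n)) (S₂ := ShortComplex.mk _ _ hw)
      (eqToIso e₁) (E.resCochainXIso A n (i + 1) h₀).symm (eqToIso e₂) ?_ ?_)
      (E.res_conf A n)
    · dsimp
      rw [ha']
      simp
    · dsimp
      rw [hb₂]
      simp

/-- The embedding `F ⥤ K^{-,b}(P)` sending an object to its projective resolution. -/
noncomputable def embedding : F ⥤ E.Kmb :=
  E.KmbProp.lift
    (E.resFunctor ⋙ ComplexShape.embeddingDownNat.extendHomotopyFunctor E.ProjInj)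
    (fun A => ⟨E.resCochain A, ⟨⟨0, E.isZero_resCochain_X A⟩, 0, E.conflationsUpTo_resCochain A⟩,
      ⟨Iso.refl _⟩⟩)

end Resolution
end ExactStructure

/-! The comparison theorem for projective resolutions carries the whole argument. It is phrased for
a complex in degrees `≤ 0` with an augmentation (`IsAug`). A map from `X⁰` to the augmented object
that kills the incoming differential is covered by a chain map (`IsAug.exists_hom`). When `X` lives
in degrees `≤ 0`, this chain map is unique up to homotopy (`IsAug.quotient_map_eq`). The additivity
and the essential image of the embedding follow. Moreover the cone of a lifted inflation resolves
the cokernel (`isAug_mappingCone`), so conflations become triangles. Their connecting morphisms are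
natural because `Hom(A[1], B) = 0` for `A`, `B` in `F`.

Maps out of `K^{>0}` vanish for degree reasons. Maps from `F` to `K^{<0}` vanish because the terms
of the target are injective (`nonempty_homotopy_zero_of_conflations`). To generate everything, a
stupid truncation splits off the part in degrees `> 0`. What remains lies in degrees `≤ 0` and is
treated by induction on the number of top degrees without conflations (`extensionProduct_toKmb`).
Two facts drive the induction. The triangle `ΣA ⟶ A[1] ⟶ I(A)[1]` puts `F[1]` inside `F * K^{<0}`. A
triangle `Q ⟶ T ⟶ A` with `Q` projective splits, so `P * F` lies in `F`.

The outer pieces of the decomposition are bounded and vanish in the Verdier quotient, so every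
object of the quotient comes from `F`. By the same orthogonality, a map `A ⟶ S ⟶ B` with `S` bounded
factors through a complex in degree 0, that is, through an object of `P` (`exists_factorization`).
This gives faithfulness on the stable category, and a similar truncation of the cone of the
denominator gives fullness. Finally, a standard Happel triangle comes from the conflation `A ⟶ B ⊕
I(A) ⟶ C`, whose summand `I(A)` dies in the quotient (`distinguished_of_isPushout`). The converse
holds because cones are unique up to isomorphism and the functor is fully faithful. -/

/-! ### Solving `δ y = z` degree by degree -/

section

open CochainComplex.HomComplex

variable {C : Type u} [Category.{v} C] [Preadditive C]

/-- A cocycle vanishing in degrees `≥ k` is a coboundary if, in degrees `< k`, morphisms into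
cycles of the target lift along the differential. -/
lemma CochainComplex.HomComplex.exists_δ_eq_of_lifting {X N : CochainComplex C ℤ} {n m : ℤ}
    (hnm : n + 1 = m) (z : Cochain X N m) (hz : δ m (m + 1) z = 0) (k : ℤ)
    (hk : ∀ p q (h : p + m = q), k ≤ p → z.v p q h = 0)
    (lift : ∀ p q q' : ℤ, p + n = q → q + 1 = q' → p < k → ∀ h : X.X p ⟶ N.X q',
      h ≫ N.d q' (q' + 1) = 0 → ∃ l : X.X p ⟶ N.X q, l ≫ N.d q q' = h) :
    ∃ y : Cochain X N n, δ n m y = z ∧ ∀ p q (h : p + n = q), k ≤ p → y.v p q h = 0 := by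
  -- Stage `j` solves the equation in degrees `≥ k - j`. Passing to the next stage changes `y` only
  -- in degree `k - j - 1`, so each component is eventually constant.
  let P (j : ℕ) (y : Cochain X N n) : Prop :=
    ∀ p q (h : p + m = q), k - j ≤ p → (z - δ n m y).v p q h = 0
  have step : ∀ (j : ℕ) (y : { y // P j y }), ∃ y' : { y // P (j + 1) y },
      ∀ p q (h : p + n = q), k - j ≤ p → y'.1.v p q h = y.1.v p q h := by
    rintro j ⟨y, hy⟩
    let w := z - δ n m y
    have hw : δ m (m + 1) w = 0 := by simp [w, hz, δ_δ]
    let p₀ := k - j - 1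
    -- The error `w` is a cocycle that vanishes in degree `p₀ + 1`, so its component in degree `p₀`
    -- lands in cycles and can be lifted.
    obtain ⟨l, hl⟩ := lift p₀ (p₀ + n) (p₀ + m) rfl (by lia) (by lia)
      (w.v p₀ (p₀ + m) rfl) (by
        have := Cochain.congr_v hw p₀ (p₀ + m + 1) (by lia)
        rw [δ_v m (m + 1) rfl w p₀ (p₀ + m + 1) (by lia) (p₀ + m) (p₀ + 1) (by lia) rfl,
          hy (p₀ + 1) _ _ (by lia)] at this
        simpa using this)
    refine ⟨⟨y + Cochain.single l n, ?_⟩, ?_⟩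
    · intro p q h hp
      rw [δ_add, ← sub_sub, Cochain.sub_v, δ_v n m hnm _ p q h (p + n) (p + 1) (by lia) rfl]
      rw [Cochain.single_v_eq_zero _ _ (p + 1) q _ (by push_cast at hp; lia)]
      by_cases hp' : p = p₀
      · subst hp'
        obtain rfl : q = p₀ + m := h.symm
        rw [Cochain.single_v, hl]
        simp [w]
      · rw [Cochain.single_v_eq_zero _ _ p _ _ hp', hy p q h (by push_cast at hp; lia)]
        simp
    · intro p q h hp
      dsimp
      rw [Cochain.single_v_eq_zero _ _ _ _ _ (by lia), add_zero]
  choose φ hφ using step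
  let s : ∀ j, { y // P j y } := fun j => Nat.rec ⟨0, fun p q h hp => by
    simpa using hk p q h (by simpa using hp)⟩ (fun j y => φ j y) j
  have s_succ : ∀ j, s (j + 1) = φ j (s j) := fun _ => rfl
  have hs : ∀ (i j : ℕ) p q (h : p + n = q), k - j ≤ p →
      (s (j + i)).1.v p q h = (s j).1.v p q h := by
    intro i j p q h hp
    induction i with
    | zero => rfl
    | succ i hi => rw [← add_assoc, s_succ, hφ _ _ p q h (by push_cast; lia), hi]
  have hs' : ∀ (j : ℕ) p q (h : p + n = q), k - j ≤ p →
      (s (k - p).toNat).1.v p q h = (s j).1.v p q h := by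
    intro j p q h hp
    obtain ⟨i, hi⟩ := Nat.exists_eq_add_of_le (show (k - p).toNat ≤ j by lia)
    rw [hi, hs _ _ _ _ _ (by lia)]
  -- Stage `(k - p).toNat` is one at which the component in degree `p` has reached its final value.
  refine ⟨Cochain.mk (fun p q h => (s (k - p).toNat).1.v p q h), ?_, ?_⟩
  · ext p q h
    have := (s (k - p).toNat).2 p q h (by lia)
    rw [Cochain.sub_v, sub_eq_zero] at this
    rw [this, δ_v n m hnm _ p q h (p + n) (p + 1) (by lia) rfl,
      δ_v n m hnm _ p q h (p + n) (p + 1) (by lia) rfl, Cochain.mk_v, Cochain.mk_v,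
      hs' (k - p).toNat (p + 1) q _ (by lia)]
  · intro p q h hp
    rw [Cochain.mk_v, show (k - p).toNat = 0 by lia]
    simp [s]

end

namespace ExactStructure

/-! ### The comparison theorem for augmented complexes -/

section Augmented

open CochainComplex.HomComplex

variable {F : Type u} [Category.{v} F] [Preadditive F] {E : ExactStructure F}

/-- A complex `X` in degrees `≤ 0` together with a deflation `ε : X⁰ ⟶ A` such that
the augmented complex becomes exact after applying `Hom(Q, -)` for all projectives `Q`. -/
structure IsAug (X : CochainComplex E.ProjInj ℤ) {A : F} (ε : (X.X 0).obj ⟶ A) : Prop where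
  isZero : ∀ i, 0 < i → IsZero (X.X i)
  deflation : E.IsDeflation ε
  w : (X.d (-1) 0).hom ≫ ε = 0
  lift_zero : ∀ {Q : E.ProjInj} (h : Q ⟶ X.X 0), h.hom ≫ ε = 0 →
    ∃ l : Q ⟶ X.X (-1), l ≫ X.d (-1) 0 = h
  lift_neg : ∀ {Q : E.ProjInj} (i j k : ℤ), i + 1 = j → j + 1 = k → j < 0 → ∀ h : Q ⟶ X.X j,
    h ≫ X.d j k = 0 → ∃ l : Q ⟶ X.X i, l ≫ X.d i j = h

/-- Uniqueness of lifts. In degree 0 the difference is killed by `ε` and lifts to `N⁻¹`. After this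
correction the remaining cocycle vanishes in degrees `≥ 0`, and exactness of `N` solves for the
rest. -/
lemma IsAug.nonempty_homotopy {X N : CochainComplex E.ProjInj ℤ} {B : F} {ε : (N.X 0).obj ⟶ B}
    (hN : IsAug N ε) (hX : ∀ i, 0 < i → IsZero (X.X i)) (f g : X ⟶ N)
    (h : (f.f 0).hom ≫ ε = (g.f 0).hom ≫ ε) : Nonempty (Homotopy f g) := by
  obtain ⟨l, hl⟩ := hN.lift_zero (f.f 0 - g.f 0) (by
    change ((f.f 0).hom - (g.f 0).hom) ≫ ε = 0
    rw [Preadditive.sub_comp, h, sub_self])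
  let y₀ : Cochain X N (-1) := Cochain.single l (-1)
  obtain ⟨y, hy, -⟩ := exists_δ_eq_of_lifting (n := -1) (m := 0) (by simp)
    (Cochain.ofHom (f - g) - δ (-1) 0 y₀) (by simp [δ_δ]) 0 (by
      intro p q h hp
      obtain rfl : q = p := by lia
      rcases hp.eq_or_lt with rfl | hp
      · rw [Cochain.sub_v, δ_v (-1) 0 (by simp) _ 0 0 h (-1) 1 (by simp) (by simp),
          Cochain.single_v, hl, Cochain.single_v_eq_zero _ _ 1 _ _ (by simp)]
        simp
      · exact (hX _ hp).eq_of_src _ _)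
    (fun p q q' hp hq hp' h hh => hN.lift_neg q q' (q' + 1) hq rfl (by lia) h hh)
  exact ⟨(Cochain.equivHomotopy f g).symm ⟨y + y₀, by
    rw [δ_add, hy]
    simp⟩⟩

/-- Existence of lifts. Components in degrees `0` and `-1` are built by hand. They form a cochain
`y₀` whose failure to be a chain map lies in degrees `< -1`, where exactness of `N` corrects it. -/
lemma IsAug.exists_hom {X N : CochainComplex E.ProjInj ℤ} {B : F} {ε : (N.X 0).obj ⟶ B}
    (hN : IsAug N ε) (t : (X.X 0).obj ⟶ B)
    (ht : (X.d (-1) 0).hom ≫ t = 0) : ∃ f : X ⟶ N, (f.f 0).hom ≫ ε = t := by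
  obtain ⟨t', ht'⟩ := (X.X 0).property.1 ε hN.deflation t
  let τ : X.X 0 ⟶ N.X 0 := ObjectProperty.homMk t'
  obtain ⟨l, hl⟩ := hN.lift_zero (X.d (-1) 0 ≫ τ) (by
    change ((X.d (-1) 0).hom ≫ t') ≫ ε = 0
    rw [assoc, ht', ht])
  let y₀ : Cochain X N 0 := Cochain.single τ 0 + Cochain.single l 0
  obtain ⟨y, hy, hy'⟩ := exists_δ_eq_of_lifting (n := 0) (m := 1) (by simp)
    (δ 0 1 y₀) (δ_δ _ _ _ _) (-1) (by
      intro p q h hp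
      by_cases hp₁ : p = -1
      · obtain rfl : q = 0 := by lia
        subst hp₁
        rw [δ_zero_cochain_v]
        simp only [y₀, Cochain.add_v]
        rw [Cochain.single_v, Cochain.single_v, Cochain.single_v_eq_zero _ _ (-1) _ _ (by simp),
          Cochain.single_v_eq_zero _ _ 0 _ _ (by simp), zero_add, add_zero, hl, sub_self]
      · exact (hN.isZero q (by lia)).eq_of_tgt _ _)
    (fun p q q' hp hq hp' h hh => hN.lift_neg q q' (q' + 1) hq rfl (by lia) h hh)
  -- The correction `y` vanishes in degrees `≥ -1`, so the component in degree 0 is still `τ`.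
  refine ⟨Cocycle.homOf (Cocycle.mk (y₀ - y) 1 (by simp) (by rw [δ_sub, hy, sub_self])), ?_⟩
  have : (Cocycle.homOf (Cocycle.mk (y₀ - y) 1 (by simp)
      (by rw [δ_sub, hy, sub_self]))).f 0 = τ := by
    simp only [Cocycle.homOf_f, Cocycle.mk_coe, Cochain.sub_v]
    rw [hy' 0 0 _ (by simp), sub_zero]
    simp only [y₀, Cochain.add_v]
    rw [Cochain.single_v, Cochain.single_v_eq_zero _ _ 0 _ _ (by simp), add_zero]
  rw [this]
  exact ht'

lemma IsAug.quotient_map_eq {X N : CochainComplex E.ProjInj ℤ} {B : F} {ε : (N.X 0).obj ⟶ B}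
    (hN : IsAug N ε) (hX : ∀ i, 0 < i → IsZero (X.X i)) (f g : X ⟶ N)
    (h : (f.f 0).hom ≫ ε = (g.f 0).hom ≫ ε) :
    (HomotopyCategory.quotient _ _).map f = (HomotopyCategory.quotient _ _).map g :=
  HomotopyCategory.eq_of_homotopy _ _ (hN.nonempty_homotopy hX f g h).some

/-- Two resolutions of the same object are isomorphic in the homotopy category. -/
lemma IsAug.exists_iso {X N : CochainComplex E.ProjInj ℤ} {B : F} {ε' : (X.X 0).obj ⟶ B}
    {ε : (N.X 0).obj ⟶ B} (hX : IsAug X ε') (hN : IsAug N ε) :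
    ∃ (f : X ⟶ N) (e : (HomotopyCategory.quotient _ _).obj X ≅
      (HomotopyCategory.quotient _ _).obj N),
      (f.f 0).hom ≫ ε = ε' ∧ e.hom = (HomotopyCategory.quotient _ _).map f := by
  obtain ⟨f, hf⟩ := hN.exists_hom ε' hX.w
  obtain ⟨g, hg⟩ := hX.exists_hom ε hN.w
  refine ⟨f, ⟨(HomotopyCategory.quotient _ _).map f, (HomotopyCategory.quotient _ _).map g, ?_, ?_⟩,
    hf, rfl⟩
  · rw [← Functor.map_comp, ← CategoryTheory.Functor.map_id]
    refine hX.quotient_map_eq hX.isZero _ _ ?_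
    change ((f.f 0).hom ≫ (g.f 0).hom) ≫ ε' = 𝟙 _ ≫ ε'
    rw [assoc, hg, hf, id_comp]
  · rw [← Functor.map_comp, ← CategoryTheory.Functor.map_id]
    refine hN.quotient_map_eq hN.isZero _ _ ?_
    change ((g.f 0).hom ≫ (f.f 0).hom) ≫ ε = 𝟙 _ ≫ ε
    rw [assoc, hf, hg, id_comp]

/-- The augmentation is `b⁰ : X⁰ ⟶ Y⁰`. A map from a projective killed by `b^j` factors through
`Y^{j-1}`, then lifts along the deflation `b^{j-1}`. -/
lemma ConflationsUpTo.exists_isAug {X : CochainComplex E.ProjInj ℤ}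
    [HasZeroObject F] [HasBinaryBiproducts F]
    (hX : ∀ i, 0 < i → IsZero (X.X i)) (h : E.ConflationsUpTo X 0) :
    ∃ (A : F) (ε : (X.X 0).obj ⟶ A), IsAug X ε := by
  obtain ⟨Y, a, b, h⟩ := h
  have hd : ∀ i j, i + 1 = j → i < 0 → ∃ (a' : Y i ⟶ (X.X j).obj) (w : a' ≫ b j = 0),
      (X.d i j).hom = b i ≫ a' ∧ E.conf (ShortComplex.mk a' (b j) w) := by
    rintro i _ rfl hi
    exact ⟨a i, (h i hi).2.choose, (h i hi).1, (h i hi).2.choose_spec⟩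
  have ex : ∀ i j, i + 1 = j → j ≤ 0 → ∀ {Q : E.ProjInj} (t : Q ⟶ X.X j), t.hom ≫ b j = 0 →
      ∃ l : Q ⟶ X.X i, l ≫ X.d i j = t := by
    intro i j hij hj Q t ht
    obtain ⟨a', w, hd', hc⟩ := hd i j hij (by lia)
    -- The conflation one degree lower is needed only to know that `b i` is a deflation.
    obtain ⟨a'', w', hd'', hc'⟩ := hd (i - 1) i (by lia) (by lia)
    obtain ⟨s, hs⟩ := conf_lift hc t.hom ht
    obtain ⟨l, hl⟩ := Q.property.1 (b i) ⟨_, _, _, hc'⟩ s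
    refine ⟨ObjectProperty.homMk l, ObjectProperty.hom_ext _ ?_⟩
    change l ≫ (X.d i j).hom = t.hom
    rw [hd', reassoc_of% hl]
    exact hs
  obtain ⟨a', w, hd', hc⟩ := hd (-1) 0 (by simp) (by simp)
  refine ⟨Y 0, b 0, hX, ⟨_, _, _, hc⟩, ?_, ex (-1) 0 (by simp) le_rfl, ?_⟩
  · rw [hd', assoc, w, comp_zero]
  · intro Q i j k hij hjk hj t ht
    obtain ⟨a'', w', hd'', hc'⟩ := hd j k hjk hj
    have : Mono a'' := conf_mono hc'
    refine ex i j hij hj.le t ?_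
    rw [← cancel_mono a'', zero_comp, assoc, ← hd'']
    exact E.projInj.ι.congr_map ht

end Augmented

end ExactStructure

namespace ExactStructure

/-! ### The embedding of `F`: full faithfulness and essential image -/

section Embedding

variable {F : Type u} [Category.{v} F] [Preadditive F] (E : ExactStructure F) [E.IsFrobenius]

/-- The augmentation `P(A) ⟶ A` of the resolution of `A`. -/
noncomputable def resε (A : F) : (E.resObj A 0).obj ⟶ A := E.coverπ A

lemma resι_ε (A : F) : E.resι A 0 ≫ E.resε A = 0 := E.cover_w A

lemma resε_conf (A : F) : E.conf (ShortComplex.mk _ _ (E.resι_ε A)) := E.cover_conf A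

instance (A : F) : Epi (E.resε A) := conf_epi (E.resε_conf A)

lemma resMap_ε {A B : F} (f : A ⟶ B) :
    ((E.resMap f).f 0).hom ≫ E.resε B = E.resε A ≫ f := E.resMap_π f

/-- A homotopy changes the degree 0 component by a map through `resι`, which the augmentation kills.
Since augmentations are epimorphisms, the homotopy class determines the morphism. -/
instance : E.resFunctor.Faithful where
  map_injective {A B f g} h := by
    have ho := HomotopyCategory.homotopyOfEq (E.resMap f) (E.resMap g) h
    have h₀ := ho.comm 0
    rw [Homotopy.dNext_zero_chainComplex, Homotopy.prevD_chainComplex, zero_add] at h₀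
    rw [← cancel_epi (E.resε A)]
    refine (E.resMap_ε f).symm.trans (Eq.trans ?_ (E.resMap_ε g))
    rw [h₀, resChain_d]
    change ((ho.hom 0 1).hom ≫ (E.resπ B 1 ≫ E.resι B 0) + ((E.resMap g).f 0).hom) ≫
      E.resε B = _
    rw [Preadditive.add_comp, assoc, assoc, resι_ε, comp_zero, comp_zero, zero_add]

/-- A chain map composed with the target augmentation kills `resι A 0`, so it descends to the
cokernel `A`. The induced map has a lift homotopic to the given one. -/
instance : E.resFunctor.Full where
  map_surjective {A B} φ := by
    obtain ⟨g, rfl⟩ := (HomotopyCategory.quotient _ _).map_surjective φ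
    have w : E.resι A 0 ≫ (g.f 0).hom ≫ E.resε B = 0 := by
      have : Epi (E.resπ A 1) := conf_epi (E.res_conf A 1)
      rw [← cancel_epi (E.resπ A 1), comp_zero, ← assoc, ← assoc]
      have := E.projInj.ι.congr_map (g.comm 1 0)
      rw [resChain_d, resChain_d] at this
      change (g.f 1).hom ≫ (E.resπ B 1 ≫ E.resι B 0) =
        (E.resπ A 1 ≫ E.resι A 0) ≫ (g.f 0).hom at this
      rw [← this, assoc, assoc, resι_ε, comp_zero, comp_zero]
    obtain ⟨f, hf⟩ := conf_desc (E.resε_conf A) _ w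
    exact ⟨f, E.quotient_map_eq _ _ ((E.resMap_ε f).trans hf)⟩

variable [HasZeroObject F] [HasBinaryBiproducts F]

instance : E.embedding.Full :=
  Functor.Full.of_comp_faithful_iso (H := E.resFunctor ⋙
    ComplexShape.embeddingDownNat.extendHomotopyFunctor E.ProjInj) (E.KmbProp.liftCompιIso _ _)

instance : E.embedding.Faithful :=
  Functor.Faithful.of_comp_iso (H := E.resFunctor ⋙
    ComplexShape.embeddingDownNat.extendHomotopyFunctor E.ProjInj) (E.KmbProp.liftCompιIso _ _)

/-- The map of cochain complexes inducing `E.embedding.map f`. -/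
noncomputable def resCochainMap {A B : F} (f : A ⟶ B) : E.resCochain A ⟶ E.resCochain B :=
  HomologicalComplex.extendMap (E.resMap f) ComplexShape.embeddingDownNat

/-- The augmentation of the cochain complex `E.resCochain A`. -/
noncomputable def resCochainε (A : F) : ((E.resCochain A).X 0).obj ⟶ A :=
  (E.resCochainXIso A 0 0 rfl).hom ≫ E.resε A

lemma resCochainMap_ε {A B : F} (f : A ⟶ B) :
    ((E.resCochainMap f).f 0).hom ≫ E.resCochainε B = E.resCochainε A ≫ f := by
  have h : (E.resCochainMap f).f 0 = _ :=
    HomologicalComplex.extendMap_f (E.resMap f) ComplexShape.embeddingDownNat (i := 0) (i' := 0) rfl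
  have h' : ((E.resCochainMap f).f 0).hom = (E.resCochainXIso A 0 0 rfl).hom ≫
    ((E.resMap f).f 0).hom ≫ (E.resCochainXIso B 0 0 rfl).inv := E.projInj.ι.congr_map h
  rw [h', resCochainε, resCochainε]
  simp only [assoc, Iso.inv_hom_id_assoc]
  rw [resMap_ε]

lemma isAug_resCochain (A : F) : IsAug (E.resCochain A) (E.resCochainε A) := by
  have := E.iso_closed
  have ex : ∀ (n : ℕ) (i j : ℤ) (hi : -((n + 1 : ℕ) : ℤ) = i) (hj : -(n : ℤ) = j)
    {Q : E.ProjInj} (h : Q ⟶ (E.resCochain A).X j),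
    h.hom ≫ (E.resCochainXIso A n j hj).hom ≫ E.resπ A n = 0 →
      ∃ l : Q ⟶ (E.resCochain A).X i, l ≫ (E.resCochain A).d i j = h := by
    intro n i j hi hj Q h w
    obtain ⟨s, hs⟩ := conf_lift (E.res_conf A n) (h.hom ≫ (E.resCochainXIso A n j hj).hom)
      (by rw [assoc]; exact w)
    obtain ⟨l, hl⟩ := Q.property.1 (E.resπ A (n + 1)) ⟨_, _, _, E.res_conf A (n + 1)⟩ s
    refine ⟨ObjectProperty.homMk (l ≫ (E.resCochainXIso A (n + 1) i hi).inv),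
      ObjectProperty.hom_ext _ ?_⟩
    change (l ≫ (E.resCochainXIso A (n + 1) i hi).inv) ≫ ((E.resCochain A).d i j).hom = h.hom
    rw [E.resCochain_d A n i j hi hj]
    dsimp at hs
    simp [reassoc_of% hl, reassoc_of% hs]
  refine ⟨E.isZero_resCochain_X A, ?_, ?_, fun h w => ex 0 _ _ rfl rfl h w, ?_⟩
  · refine ⟨_, E.resι A 0 ≫ (E.resCochainXIso A 0 0 rfl).inv, by simp [resCochainε, resι_ε], ?_⟩
    exact E.conf.prop_of_iso (ShortComplex.isoMk
      (S₁ := ShortComplex.mk _ _ (E.resι_ε A)) (S₂ := ShortComplex.mk _ _ _)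
      (Iso.refl _) (E.resCochainXIso A 0 0 rfl).symm (Iso.refl _) (by simp)
      (by simp [resCochainε])) (E.resε_conf A)
  · rw [E.resCochain_d A 0 (-1) 0 rfl rfl, resCochainε]
    simp [resι_ε]
  · intro Q i j k hij hjk hj h w
    obtain ⟨n, hn⟩ : ∃ n : ℕ, -((n + 1 : ℕ) : ℤ) = j := ⟨(-j).toNat - 1, by lia⟩
    refine ex (n + 1) i j (by lia) hn h ?_
    have : Mono (E.resι A n) := conf_mono (E.res_conf A n)
    have h' : h.hom ≫ ((E.resCochain A).d j k).hom = 0 := E.projInj.ι.congr_map w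
    rw [E.resCochain_d A n j k hn (by lia), ← assoc, ← assoc, ← assoc] at h'
    rw [← cancel_mono (E.resι A n), ← cancel_mono (E.resCochainXIso A n k (by lia)).inv,
      zero_comp, zero_comp]
    simpa only [assoc] using h'

/-- Both sides cover `f + g` on augmentations, hence agree by uniqueness of lifts. -/
instance : E.embedding.Additive where
  map_add {A B f g} := by
    apply ObjectProperty.hom_ext
    refine Eq.trans ?_ ((HomotopyCategory.quotient _ _).map_add
      (f := E.resCochainMap f) (g := E.resCochainMap g))
    refine (E.isAug_resCochain B).quotient_map_eq (E.isZero_resCochain_X A)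
      (E.resCochainMap (f + g)) (E.resCochainMap f + E.resCochainMap g) ?_
    rw [resCochainMap_ε]
    change _ = (((E.resCochainMap f).f 0).hom + ((E.resCochainMap g).f 0).hom) ≫ _
    rw [Preadditive.add_comp, resCochainMap_ε, resCochainMap_ε, Preadditive.comp_add]

/-- A complex with conflations in all degrees `≤ 0` is an augmented resolution of some `A`, and two
resolutions of `A` are homotopy equivalent. -/
lemma embedding_essImage : E.embedding.essImage = E.resolutions := by
  ext X
  constructor
  · rintro ⟨A, ⟨e⟩⟩
    exact ⟨E.resCochain A, ⟨E.isZero_resCochain_X A, E.conflationsUpTo_resCochain A⟩,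
      ⟨E.KmbProp.ι.mapIso e⟩⟩
  · rintro ⟨K, ⟨hK, hK'⟩, ⟨e⟩⟩
    obtain ⟨A, ε, hε⟩ := hK'.exists_isAug hK
    obtain ⟨_, e', -⟩ := (E.isAug_resCochain A).exists_iso hε
    exact ⟨A, ⟨E.KmbProp.fullyFaithfulι.preimageIso (e' ≪≫ e)⟩⟩

end Embedding

end ExactStructure

/-! ### Triangles in full subcategories, and exactness for triangles given by their morphisms -/

/-- A triangle in a full triangulated subcategory is distinguished as soon as it is
distinguished in the ambient category. -/
lemma CategoryTheory.ObjectProperty.exists_distTriang_fullSubcategory {C : Type*} [Category C]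
    [Preadditive C] [HasZeroObject C] [HasShift C ℤ] [∀ n : ℤ, (shiftFunctor C n).Additive]
    [Pretriangulated C] (P : ObjectProperty C) [P.IsTriangulated] {X Y Z : P.FullSubcategory}
    (f : X ⟶ Y) (g : Y ⟶ Z) (h : Z.obj ⟶ X.obj⟦(1 : ℤ)⟧)
    (H : Triangle.mk f.hom g.hom h ∈ distTriang C) :
    ∃ h', Triangle.mk f g h' ∈ distTriang P.FullSubcategory := by
  refine ⟨P.fullyFaithfulι.preimage (h ≫ (P.ι.commShiftIso (1 : ℤ)).inv.app X), ?_⟩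
  refine isomorphic_distinguished _ H _
    (Triangle.isoMk _ _ (Iso.refl _) (Iso.refl _) (Iso.refl _) ?_ ?_ ?_)
  · exact (comp_id _).trans (id_comp _).symm
  · exact (comp_id _).trans (id_comp _).symm
  · have : P.ι.map (P.fullyFaithfulι.preimage (h ≫ (P.ι.commShiftIso (1 : ℤ)).inv.app X)) =
      h ≫ (P.ι.commShiftIso (1 : ℤ)).inv.app X := P.fullyFaithfulι.map_preimage _
    have key : P.ι.map (P.fullyFaithfulι.preimage (h ≫ (P.ι.commShiftIso (1 : ℤ)).inv.app X)) ≫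
        (P.ι.commShiftIso (1 : ℤ)).hom.app X = h := by
      rw [this, assoc, Iso.inv_hom_id_app]
      exact comp_id _
    refine (congrArg₂ (· ≫ ·) key ((shiftFunctor C (1 : ℤ)).map_id X.obj)).trans ?_
    exact (comp_id h).trans (id_comp h).symm

section

variable {C : Type*} [Category C]
    [Preadditive C] [HasZeroObject C] [HasShift C ℤ] [∀ n : ℤ, (shiftFunctor C n).Additive]
    [Pretriangulated C] {X Y Z X' Y' Z' W : C} {f : X ⟶ Y} {g : Y ⟶ Z} {h : Z ⟶ X⟦(1 : ℤ)⟧}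
    {f' : X' ⟶ Y'} {g' : Y' ⟶ Z'} {h' : Z' ⟶ X'⟦(1 : ℤ)⟧}

namespace CategoryTheory.Pretriangulated

lemma exists_hom₃_of_mk (H : Triangle.mk f g h ∈ distTriang C)
    (H' : Triangle.mk f' g' h' ∈ distTriang C) (a : X ⟶ X') (b : Y ⟶ Y') (w : f ≫ b = a ≫ f') :
    ∃ c : Z ⟶ Z', g ≫ c = b ≫ g' ∧ h ≫ a⟦(1 : ℤ)⟧' = c ≫ h' :=
  complete_distinguished_triangle_morphism _ _ H H' a b w

lemma exists_desc₂_of_mk (H : Triangle.mk f g h ∈ distTriang C) (t : Y ⟶ W) (ht : f ≫ t = 0) :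
    ∃ s : Z ⟶ W, t = g ≫ s :=
  Triangle.yoneda_exact₂ _ H t ht

lemma exists_desc₃_of_mk (H : Triangle.mk f g h ∈ distTriang C) (t : Z ⟶ W) (ht : g ≫ t = 0) :
    ∃ s : X⟦(1 : ℤ)⟧ ⟶ W, t = h ≫ s :=
  Triangle.yoneda_exact₃ _ H t ht

lemma exists_lift₂_of_mk (H : Triangle.mk f g h ∈ distTriang C) (t : W ⟶ Y) (ht : t ≫ g = 0) :
    ∃ s : W ⟶ X, t = s ≫ f :=
  Triangle.coyoneda_exact₂ _ H t ht

lemma exists_lift₃_of_mk (H : Triangle.mk f g h ∈ distTriang C) (t : W ⟶ Z) (ht : t ≫ h = 0) :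
    ∃ s : W ⟶ Y, t = s ≫ g :=
  Triangle.coyoneda_exact₃ _ H t ht

lemma distTriang_mk_of_iso (H : Triangle.mk f g h ∈ distTriang C) (e₁ : X' ≅ X) (e₂ : Y' ≅ Y)
    (e₃ : Z' ≅ Z) (w₁ : f' ≫ e₂.hom = e₁.hom ≫ f) (w₂ : g' ≫ e₃.hom = e₂.hom ≫ g)
    (w₃ : h' ≫ e₁.hom⟦(1 : ℤ)⟧' = e₃.hom ≫ h) : Triangle.mk f' g' h' ∈ distTriang C :=
  isomorphic_distinguished _ H _ (Triangle.isoMk _ _ e₁ e₂ e₃ w₁ w₂ w₃)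

lemma exists_iso₃_of_mk {k : Y ⟶ Z'} {l : Z' ⟶ X⟦(1 : ℤ)⟧} (H : Triangle.mk f g h ∈ distTriang C)
    (H' : Triangle.mk f k l ∈ distTriang C) : ∃ e : Z ≅ Z', g ≫ e.hom = k ∧ h = e.hom ≫ l := by
  let e := isoTriangleOfIso₁₂ _ _ H H' (Iso.refl X) (Iso.refl Y)
    ((comp_id f).trans (id_comp f).symm)
  have h₂ : g ≫ e.hom.hom₃ = 𝟙 Y ≫ k := e.hom.comm₂
  have h₃ : h ≫ (𝟙 X)⟦(1 : ℤ)⟧' = e.hom.hom₃ ≫ l := e.hom.comm₃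
  refine ⟨Triangle.π₃.mapIso e, h₂.trans (id_comp k), ?_⟩
  rw [CategoryTheory.Functor.map_id, comp_id] at h₃
  exact h₃

end CategoryTheory.Pretriangulated

end

namespace ExactStructure

/-! ### The cone of a lifted inflation -/

section Cone

open CochainComplex CochainComplex.HomComplex

variable {F : Type u} [Category.{v} F] [Preadditive F] {E : ExactStructure F}

lemma deflation_of_isIso {A B : F} (e : A ⟶ B) [IsIso e] : E.IsDeflation e :=
  deflation_of_isPullback (IsPullback.of_horiz_isIso (fst := e) (snd := e) (f := 𝟙 B) (g := 𝟙 B)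
    ⟨rfl⟩) (E.id_deflation B)

variable [HasZeroObject F] [HasBinaryBiproducts F]

/-- In degree 0 the cone is `Y⁰`, because `X¹ = 0`. It is augmented by `Y⁰ ⟶ B ⟶ C`. Exactness is
the long exact sequence argument carried out on maps from projectives. The exactness of the
conflation enters in degree 0 and the monomorphism `ι` in degree `-1`. -/
lemma isAug_mappingCone {X Y : CochainComplex E.ProjInj ℤ} {A B C : F} {εX : (X.X 0).obj ⟶ A}
    {εY : (Y.X 0).obj ⟶ B} (hX : IsAug X εX) (hY : IsAug Y εY) (φ : X ⟶ Y) {ι : A ⟶ B} {p : B ⟶ C}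
    {w : ι ≫ p = 0} (hc : E.conf (ShortComplex.mk ι p w)) (hφ : (φ.f 0).hom ≫ εY = εX ≫ ι) :
    IsAug (mappingCone φ) (((mappingCone.snd φ).v 0 0 (add_zero 0)).hom ≫ εY ≫ p) := by
  have : Mono ι := conf_mono hc
  have hs : (mappingCone.inr φ).f 0 ≫ (mappingCone.snd φ).v 0 0 (add_zero 0) = 𝟙 _ :=
    mappingCone.inr_f_snd_v φ 0
  have hfst : (mappingCone.fst φ).1.v 0 1 rfl = 0 := (hX.isZero 1 (by simp)).eq_of_tgt _ _
  have hs' : (mappingCone.snd φ).v 0 0 (add_zero 0) ≫ (mappingCone.inr φ).f 0 = 𝟙 _ := by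
    have := mappingCone.id_X φ 0 1 rfl
    rwa [hfst, zero_comp, zero_add] at this
  -- A map into the cone lifts along the differential if its `X`-component lifts to some `x'` and
  -- its `Y`-component, corrected by `x' ≫ φ`, lifts too.
  have hex : ∀ {Q : E.ProjInj} (i j : ℤ) (hij : i + 1 = j) (k l : ℤ) (hjk : j + 1 = k),
      k + 1 = l → j ≤ 0 → ∀ h : Q ⟶ (mappingCone φ).X j,
      (∃ x' : Q ⟶ X.X j, x' ≫ X.d j k = h ≫ (mappingCone.fst φ).1.v j k hjk ∧
        (∃ y' : Q ⟶ Y.X i, y' ≫ Y.d i j =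
          h ≫ (mappingCone.snd φ).v j j (add_zero j) + x' ≫ φ.f j)) →
        ∃ l : Q ⟶ (mappingCone φ).X i, l ≫ (mappingCone φ).d i j = h := by
    rintro Q i j hij k l hjk hkl hj h ⟨x', hx', y', hy'⟩
    refine ⟨-(x' ≫ (mappingCone.inl φ).v j i (by lia)) + y' ≫ (mappingCone.inr φ).f i, ?_⟩
    rw [mappingCone.ext_to_iff φ j k hjk]
    constructor
    · rw [assoc, mappingCone.d_fst_v φ i j k hij hjk]
      simp [hx']
    · rw [assoc, mappingCone.d_snd_v φ i j hij]
      simp [hy']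
  refine ⟨fun n hn => ?_, ?_, ?_, ?_, ?_⟩
  · exact isZero_mappingCone_X φ n (hX.isZero _ (by lia)) (hY.isZero _ hn)
  · have : IsIso ((mappingCone.snd φ).v 0 0 (add_zero 0)).hom :=
      ⟨((mappingCone.inr φ).f 0).hom, E.projInj.ι.congr_map hs', E.projInj.ι.congr_map hs⟩
    exact E.comp_deflation _ _ (deflation_of_isIso _)
      (E.comp_deflation _ _ hY.deflation ⟨_, _, _, hc⟩)
  · have h : ((mappingCone φ).d (-1) 0).hom ≫ ((mappingCone.snd φ).v 0 0 (add_zero 0)).hom =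
      ((mappingCone.fst φ).1.v (-1) 0 rfl).hom ≫ (φ.f 0).hom +
        ((mappingCone.snd φ).v (-1) (-1) rfl).hom ≫ (Y.d (-1) 0).hom :=
      E.projInj.ι.congr_map (mappingCone.d_snd_v φ (-1) 0 rfl)
    rw [reassoc_of% h, Preadditive.add_comp, assoc, assoc, reassoc_of% hφ, reassoc_of% hY.w, w]
    simp
  · intro Q h hh
    refine hex (-1) 0 rfl 1 2 rfl rfl le_rfl h ?_
    obtain ⟨s, hs⟩ := conf_lift hc ((h ≫ (mappingCone.snd φ).v 0 0 (add_zero 0)).hom ≫ εY) (by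
      change ((h.hom ≫ ((mappingCone.snd φ).v 0 0 (add_zero 0)).hom) ≫ εY) ≫ p = 0
      simpa using hh)
    obtain ⟨x, hx⟩ := Q.property.1 εX hX.deflation s
    dsimp at hs
    refine ⟨-ObjectProperty.homMk x, (hX.isZero 1 (by simp)).eq_of_tgt _ _, ?_⟩
    refine hY.lift_zero _ ?_
    change ((h.hom ≫ ((mappingCone.snd φ).v 0 0 (add_zero 0)).hom) + (-x) ≫ (φ.f 0).hom) ≫ εY = 0
    rw [Preadditive.add_comp, ← hs]
    simp [hφ, reassoc_of% hx]
  · intro Q i j k hij hjk hj h hh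
    have h₁ : (h ≫ (mappingCone.fst φ).1.v j k hjk) ≫ X.d k (k + 1) = 0 := by
      have := hh =≫ (mappingCone.fst φ).1.v k (k + 1) rfl
      rw [assoc, mappingCone.d_fst_v φ j k (k + 1) hjk rfl, zero_comp] at this
      simpa using this
    have h₂ : (h ≫ (mappingCone.fst φ).1.v j k hjk) ≫ φ.f k +
        (h ≫ (mappingCone.snd φ).v j j (add_zero j)) ≫ Y.d j k = 0 := by
      have := hh =≫ (mappingCone.snd φ).v k k (add_zero k)
      rw [assoc, mappingCone.d_snd_v φ j k hjk, zero_comp] at this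
      simpa using this
    refine hex i j hij k (k + 1) hjk rfl hj.le h ?_
    obtain ⟨x, hx⟩ : ∃ x' : Q ⟶ X.X j, x' ≫ X.d j k = h ≫ (mappingCone.fst φ).1.v j k hjk := by
      -- For `k = 0` the `X`-component sits in `X⁰`, where exactness is tested by `εX` instead of a
      -- differential. Composing with the monomorphism `ι` reduces this to the cycle relation in
      -- `Y`.
      by_cases hk : k = 0
      · subst hk
        obtain rfl : j = -1 := by lia
        refine hX.lift_zero _ ?_
        rw [← cancel_mono ι, zero_comp, assoc, ← hφ]
        have h₃ : (h ≫ (mappingCone.fst φ).1.v (-1) 0 hjk).hom ≫ (φ.f 0).hom +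
          (h ≫ (mappingCone.snd φ).v (-1) (-1) (add_zero (-1))).hom ≫ (Y.d (-1) 0).hom = 0 :=
            E.projInj.ι.congr_map h₂
        have := h₃ =≫ εY
        rw [Preadditive.add_comp, assoc, assoc, hY.w, zero_comp, comp_zero, add_zero] at this
        exact this
      · exact hX.lift_neg j k (k + 1) hjk rfl (by lia) _ h₁
    refine ⟨x, hx, hY.lift_neg i j k hij hjk hj _ ?_⟩
    rw [Preadditive.add_comp, assoc x, φ.comm, reassoc_of% hx, add_comm]
    simpa only [assoc] using h₂

end Cone

/-! ### Vanishing of morphisms for degree reasons -/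

section Bounds

open HomotopyCategory

variable {F : Type u} [Category.{v} F] [Preadditive F] [HasZeroObject F] [HasBinaryBiproducts F]
  (E : ExactStructure F)

/-- The objects of `K^{-,b}(P)` isomorphic to a complex vanishing in degrees `> n`. -/
def Kle (n : ℤ) : ObjectProperty E.Kmb :=
  ObjectProperty.inverseImage (ObjectProperty.map
    (fun X : CochainComplex E.ProjInj ℤ => ∀ i, n < i → IsZero (X.X i))
    (HomotopyCategory.quotient _ _)) E.KmbProp.ι

/-- The objects of `K^{-,b}(P)` isomorphic to a complex vanishing in degrees `< n`. -/
def Kge (n : ℤ) : ObjectProperty E.Kmb :=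
  ObjectProperty.inverseImage (ObjectProperty.map
    (fun X : CochainComplex E.ProjInj ℤ => ∀ i, i < n → IsZero (X.X i))
    (HomotopyCategory.quotient _ _)) E.KmbProp.ι

variable {E}

/-- The isomorphism in `K(P)` between the shift of an object of `K^{-,b}(P)` and the shift of
a complex representing it. -/
noncomputable def shiftRepr {X : E.Kmb} {K : CochainComplex E.ProjInj ℤ}
    (e : (HomotopyCategory.quotient _ _).obj K ≅ X.obj) (n : ℤ) :
    (HomotopyCategory.quotient _ _).obj (K⟦n⟧) ≅ (X⟦n⟧).obj :=
  ((HomotopyCategory.quotient _ _).commShiftIso n).app K ≪≫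
    (shiftFunctor E.KP n).mapIso e ≪≫ ((E.KmbProp.ι.commShiftIso n).app X).symm

lemma Kle.shift {X : E.Kmb} {n : ℤ} (h : E.Kle n X) (k m : ℤ) (hm : m + k = n) :
    E.Kle m (X⟦k⟧) := by
  obtain ⟨K, hK, ⟨e⟩⟩ := h
  exact ⟨K⟦k⟧, fun i hi => hK (i + k) (by lia), ⟨shiftRepr e k⟩⟩

lemma eq_zero_of_homotopy {X Y : E.Kmb} (f : X ⟶ Y) {K L : CochainComplex E.ProjInj ℤ}
    (e : (HomotopyCategory.quotient _ _).obj K ≅ X.obj)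
    (e' : (HomotopyCategory.quotient _ _).obj L ≅ Y.obj)
    (h : ∀ g : K ⟶ L, Nonempty (Homotopy g 0)) : f = 0 := by
  obtain ⟨g, hg⟩ := (HomotopyCategory.quotient _ _).map_surjective (e.hom ≫ f.hom ≫ e'.inv)
  rw [eq_of_homotopy _ _ (h g).some, Functor.map_zero] at hg
  apply ObjectProperty.hom_ext
  rw [← cancel_epi e.hom, ← cancel_mono e'.inv, assoc, ← hg]
  exact (zero_comp.symm.trans (congrArg (· ≫ e'.inv) comp_zero.symm))

lemma eq_zero_of_Kge_of_Kle {X Y : E.Kmb} (f : X ⟶ Y) {m n : ℤ} (hX : E.Kge n X) (hY : E.Kle m Y)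
    (hmn : m < n) : f = 0 := by
  obtain ⟨K, hK, ⟨e⟩⟩ := hX
  obtain ⟨L, hL, ⟨e'⟩⟩ := hY
  refine eq_zero_of_homotopy f e e' (fun g => ⟨Homotopy.ofEq ?_⟩)
  ext i : 1
  by_cases hi : i < n
  · exact (hK i hi).eq_of_src _ _
  · exact (hL i (by lia)).eq_of_tgt _ _

variable [E.IsFrobenius]

/-- A chain map from such a complex has zero component in degree 0, so uniqueness of lifts makes it
null-homotopic. In particular `Hom(A[1], B) = 0` for `A`, `B` in `F`. -/
lemma eq_zero_of_Kle_neg_one {X : E.Kmb} {B : F} (f : X ⟶ E.embedding.obj B)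
    (hX : E.Kle (-1) X) : f = 0 := by
  obtain ⟨K, hK, ⟨e⟩⟩ := hX
  exact eq_zero_of_homotopy f e (Iso.refl _) (fun g =>
    (E.isAug_resCochain B).nonempty_homotopy (fun i hi => hK i (by lia)) g 0
      (by rw [(hK 0 (by simp)).eq_of_src (g.f 0) 0]; rfl))

lemma Kle_embedding (A : F) : E.Kle 0 (E.embedding.obj A) :=
  ⟨E.resCochain A, E.isZero_resCochain_X A, ⟨Iso.refl _⟩⟩

end Bounds

/-! ### Conflations as distinguished triangles -/

section ConflationTriangle

variable {F : Type u} [Category.{v} F] [Preadditive F] [HasZeroObject F] [HasBinaryBiproducts F]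
  (E : ExactStructure F) [E.IsFrobenius]

/-- A conflation in `F` induces a distinguished triangle of projective resolutions. -/
lemma exists_distTriang_of_conf {A B C : F} {i : A ⟶ B} {p : B ⟶ C} {w : i ≫ p = 0}
    (hc : E.conf (ShortComplex.mk i p w)) : ∃ δ, Triangle.mk (E.embedding.map i)
      (E.embedding.map p) δ ∈ distTriang E.Kmb := by
  -- The cone of the lift of `i` and the chosen resolution of `C` both resolve `C`. Uniqueness of
  -- lifts then matches the inclusion of `B` into the cone with the lift of `p`.
  have h := isAug_mappingCone (E.isAug_resCochain A) (E.isAug_resCochain B) (E.resCochainMap i) hc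
    (E.resCochainMap_ε i)
  obtain ⟨f, e, hf, he⟩ := h.exists_iso (E.isAug_resCochain C)
  refine E.KmbProp.exists_distTriang_fullSubcategory _ _
    (e.inv ≫ (CochainComplex.mappingCone.triangleh (E.resCochainMap i)).mor₃)
    (isomorphic_distinguished _
      (HomotopyCategory.mappingCone_triangleh_distinguished (E.resCochainMap i)) _
      (Triangle.isoMk _ _ (Iso.refl _) (Iso.refl _) e.symm ?_ ?_ ?_))
  · exact (comp_id _).trans (id_comp _).symm
  · have : (HomotopyCategory.quotient _ _).map (E.resCochainMap p) =
        (HomotopyCategory.quotient _ _).map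
          (CochainComplex.mappingCone.inr (E.resCochainMap i)) ≫ e.hom := by
      rw [he, ← Functor.map_comp]
      refine (E.isAug_resCochain C).quotient_map_eq (E.isZero_resCochain_X B) _ _ ?_
      rw [resCochainMap_ε]
      change _ = (((CochainComplex.mappingCone.inr (E.resCochainMap i)).f 0).hom ≫ (f.f 0).hom) ≫ _
      have h₂ : ((CochainComplex.mappingCone.inr (E.resCochainMap i)).f 0).hom ≫
          ((CochainComplex.mappingCone.snd (E.resCochainMap i)).v 0 0 (add_zero 0)).hom = 𝟙 _ :=
        E.projInj.ι.congr_map (CochainComplex.mappingCone.inr_f_snd_v (E.resCochainMap i) 0)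
      rw [assoc, hf, reassoc_of% h₂]
    change (HomotopyCategory.quotient _ _).map (E.resCochainMap p) ≫ e.inv = 𝟙 _ ≫ _
    rw [this, assoc, e.hom_inv_id, comp_id]
    exact (id_comp _).symm
  · change (e.inv ≫ _) ≫ (𝟙 _)⟦1⟧' = e.inv ≫ _
    rw [CategoryTheory.Functor.map_id, comp_id]

/-- The connecting morphism of a conflation. -/
noncomputable def connecting {A B C : F} {i : A ⟶ B} {p : B ⟶ C} {w : i ≫ p = 0}
    (hc : E.conf (ShortComplex.mk i p w)) : E.embedding.obj C ⟶ (E.embedding.obj A)⟦(1 : ℤ)⟧ :=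
  (E.exists_distTriang_of_conf hc).choose

lemma connecting_distinguished {A B C : F} {i : A ⟶ B} {p : B ⟶ C} {w : i ≫ p = 0}
    (hc : E.conf (ShortComplex.mk i p w)) :
    Triangle.mk (E.embedding.map i) (E.embedding.map p) (E.connecting hc) ∈ distTriang E.Kmb :=
  (E.exists_distTriang_of_conf hc).choose_spec

/-- The connecting morphism is natural in the conflation. -/
lemma connecting_naturality {A B C A' B' C' : F} {i : A ⟶ B} {p : B ⟶ C} {w : i ≫ p = 0}
    (hc : E.conf (ShortComplex.mk i p w)) {i' : A' ⟶ B'} {p' : B' ⟶ C'} {w' : i' ≫ p' = 0}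
    (hc' : E.conf (ShortComplex.mk i' p' w')) (a : A ⟶ A') (b : B ⟶ B') (c : C ⟶ C')
    (hab : i ≫ b = a ≫ i') (hbc : p ≫ c = b ≫ p') :
    E.embedding.map c ≫ E.connecting hc' = E.connecting hc ≫ (E.embedding.map a)⟦(1 : ℤ)⟧' := by
  obtain ⟨c', h₁, h₂⟩ := exists_hom₃_of_mk (E.connecting_distinguished hc)
    (E.connecting_distinguished hc') (E.embedding.map a) (E.embedding.map b) (by
      rw [← Functor.map_comp, hab, Functor.map_comp])
  -- The axioms give only some `c'` on the third terms. Its difference from the map induced by `c`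
  -- factors through a morphism from `A[1]` to `C'`, which is zero.
  obtain ⟨t, ht⟩ := exists_desc₃_of_mk (E.connecting_distinguished hc)
    (E.embedding.map c - c') (by
      rw [Preadditive.comp_sub, h₁, ← Functor.map_comp, ← Functor.map_comp, hbc, sub_self])
  rw [eq_zero_of_Kle_neg_one t ((Kle_embedding A).shift 1 (-1) (by simp)), comp_zero,
    sub_eq_zero] at ht
  rw [ht, h₂]

end ConflationTriangle

end ExactStructure

/-! ### Stupid truncations -/

section Truncation

variable {C : Type u} [Category.{v} C] [Preadditive C] [HasZeroObject C] [HasBinaryBiproducts C]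

open ZeroObject in
/-- The distinguished triangle given by the stupid truncations `σ^{≥k} X ⟶ X ⟶ σ^{<k} X`. -/
lemma CochainComplex.exists_stupid_truncation_triangle (X : CochainComplex C ℤ) (k : ℤ) :
    ∃ (K L : CochainComplex C ℤ) (f : K ⟶ X) (g : X ⟶ L)
      (h : (HomotopyCategory.quotient C (ComplexShape.up ℤ)).obj L ⟶
        ((HomotopyCategory.quotient C (ComplexShape.up ℤ)).obj K)⟦(1 : ℤ)⟧),
      (∀ i, i < k → IsZero (K.X i)) ∧ (∀ i, k ≤ i → IsIso (f.f i)) ∧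
      (∀ i, k ≤ i → IsZero (L.X i)) ∧ (∀ i, i < k → IsIso (g.f i)) ∧
      Triangle.mk ((HomotopyCategory.quotient _ _).map f) ((HomotopyCategory.quotient _ _).map g)
        h ∈ distTriang _ := by
  -- Stating this for an arbitrary predicate `p` serves both truncations and packages the case split
  -- into maps `ι`, `ρ` that are mutually inverse or zero.
  have hY : ∀ (p : ℤ → Prop) (i : ℤ), ∃ (Y : C) (ι : Y ⟶ X.X i) (ρ : X.X i ⟶ Y),
      (p i → ι ≫ ρ = 𝟙 Y ∧ ρ ≫ ι = 𝟙 _) ∧ (¬ p i → IsZero Y) := by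
    intro p i
    by_cases h : p i
    · exact ⟨X.X i, 𝟙 _, 𝟙 _, fun _ => ⟨id_comp _, id_comp _⟩, fun h' => (h' h).elim⟩
    · exact ⟨0, 0, 0, fun h' => (h h').elim, fun _ => isZero_zero _⟩
  choose Y ι ρ hY hY₀ using hY (fun i => k ≤ i)
  -- The general statement, now shadowed, is recovered by its type.
  choose Z ι' ρ' hZ hZ₀ using ‹∀ (p : ℤ → Prop) (i : ℤ), _› (fun i => i < k)
  let K : CochainComplex C ℤ :=
    { X := Y
      d := fun i j => ι i ≫ X.d i j ≫ ρ j
      shape := fun i j hij => by rw [X.shape i j hij, zero_comp, comp_zero]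
      d_comp_d' := by
        rintro i _ _ rfl rfl
        by_cases h : k ≤ i
        · simp [reassoc_of% (hY (i + 1) (by lia)).2]
        · exact (hY₀ i h).eq_of_src _ _ }
  let L : CochainComplex C ℤ :=
    { X := Z
      d := fun i j => ι' i ≫ X.d i j ≫ ρ' j
      shape := fun i j hij => by rw [X.shape i j hij, zero_comp, comp_zero]
      d_comp_d' := by
        rintro i _ _ rfl rfl
        by_cases h : i + 1 < k
        · simp [reassoc_of% (hZ (i + 1) h).2]
        · exact (hZ₀ (i + 1 + 1) (by lia)).eq_of_tgt _ _ }
  let f : K ⟶ X :=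
    { f := ι
      comm' := by
        rintro i _ rfl
        by_cases h : k ≤ i
        · simp [K, (hY (i + 1) (by lia)).2]
        · exact (hY₀ i h).eq_of_src _ _ }
  let g : X ⟶ L :=
    { f := ρ'
      comm' := by
        rintro i _ rfl
        by_cases h : i + 1 < k
        · simp [L, reassoc_of% (hZ i (by lia)).2]
        · exact (hZ₀ (i + 1) (by lia)).eq_of_tgt _ _ }
  have w : f ≫ g = 0 := by
    ext i : 1
    by_cases h : k ≤ i
    · exact (hZ₀ i (by lia)).eq_of_tgt _ _
    · exact (hY₀ i h).eq_of_src _ _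
  -- In each degree one outer term is zero and the other is isomorphic to `X`, so the sequence is
  -- degreewise split and gives a distinguished triangle.
  let σ : ∀ n, ((ShortComplex.mk f g w).map (HomologicalComplex.eval C _ n)).Splitting := fun n =>
    { r := ρ n
      s := ι' n
      f_r := by
        by_cases h : k ≤ n
        · exact (hY n h).1
        · exact (hY₀ n h).eq_of_src _ _
      s_g := by
        by_cases h : k ≤ n
        · exact (hZ₀ n (by lia)).eq_of_src _ _
        · exact (hZ n (by lia)).1
      id := by
        change ρ n ≫ ι n + ρ' n ≫ ι' n = 𝟙 _
        by_cases h : k ≤ n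
        · rw [(hY n h).2, (hZ₀ n (by lia)).eq_of_tgt (ρ' n) 0, zero_comp, add_zero]
        · rw [(hZ n (by lia)).2, (hY₀ n h).eq_of_tgt (ρ n) 0, zero_comp, zero_add] }
  exact ⟨K, L, f, g, _, fun i hi => hY₀ i (by lia), fun i hi => ⟨ρ i, hY i hi⟩,
    fun i hi => hZ₀ i (by lia), fun i hi => ⟨ι' i, (hZ i hi).symm⟩,
    (HomotopyCategory.distinguished_iff_iso_trianglehOfDegreewiseSplit _).2
      ⟨ShortComplex.mk f g w, σ, ⟨Iso.refl _⟩⟩⟩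

end Truncation

namespace ExactStructure

/-! ### Truncations inside `K^{-,b}(P)` and orthogonality of the pieces -/

section Pieces

variable {F : Type u} [Category.{v} F] [Preadditive F] [HasZeroObject F] [HasBinaryBiproducts F]
  {E : ExactStructure F}

open ZeroObject in
-- The bound drops by one because the conflation indexed by `i` has middle term `X^{i+1}`.
lemma ConflationsUpTo.of_isZero {X : CochainComplex E.ProjInj ℤ} {m : ℤ}
    (h : ∀ i, i < m → IsZero (X.X i)) : E.ConflationsUpTo X (m - 1) := by
  refine ⟨fun _ => 0, fun _ => 0, fun _ => 0, fun i hi => ⟨?_, by simp, ?_⟩⟩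
  · rw [(h i (by lia)).eq_of_src (X.d i (i + 1)) 0]
    simp
  · exact conf_of_isZero _ _ (isZero_zero _) (E.projInj.ι.map_isZero (h (i + 1) (by lia)))
      (isZero_zero _)

lemma bounded.minusB {X : CochainComplex E.ProjInj ℤ} (h : E.bounded X) : E.minusB X :=
  ⟨h.1, _, ConflationsUpTo.of_isZero h.2.choose_spec⟩

lemma ConflationsUpTo.of_isIso {X L : CochainComplex E.ProjInj ℤ} (g : X ⟶ L) {m : ℤ}
    (hg : ∀ i, i ≤ m → IsIso (g.f i)) (h : E.ConflationsUpTo X m) : E.ConflationsUpTo L m := by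
  have := E.iso_closed
  obtain ⟨Y, a, b, h⟩ := h
  have hr : ∀ i, ∃ r : L.X i ⟶ X.X i, i ≤ m → g.f i ≫ r = 𝟙 _ ∧ r ≫ g.f i = 𝟙 _ := by
    intro i
    by_cases hi : i ≤ m
    · have := hg i hi
      exact ⟨inv (g.f i), fun _ => ⟨by simp, by simp⟩⟩
    · exact ⟨0, fun h => (hi h).elim⟩
  choose r hr using hr
  have hr₁ : ∀ i, i ≤ m → (g.f i).hom ≫ (r i).hom = 𝟙 _ := fun i hi =>
    E.projInj.ι.congr_map (hr i hi).1
  have hr₂ : ∀ i, i ≤ m → (r i).hom ≫ (g.f i).hom = 𝟙 _ := fun i hi =>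
    E.projInj.ι.congr_map (hr i hi).2
  have hd : ∀ i, (g.f i).hom ≫ (L.d i (i + 1)).hom = (X.d i (i + 1)).hom ≫ (g.f (i + 1)).hom :=
    fun i => E.projInj.ι.congr_map (g.comm i (i + 1))
  refine ⟨Y, fun i => a i ≫ (g.f (i + 1)).hom, fun i => (r i).hom ≫ b i, fun i hi => ?_⟩
  obtain ⟨h₁, w, hc⟩ := h i hi
  refine ⟨?_, by simp [reassoc_of% hr₁ (i + 1) (by lia), w], ?_⟩
  · rw [assoc, ← reassoc_of% h₁, ← hd, reassoc_of% hr₂ i hi.le]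
  · exact E.conf.prop_of_iso (ShortComplex.isoMk
      (S₁ := ShortComplex.mk _ _ w) (S₂ := ShortComplex.mk _ _ _)
      (Iso.refl _) ⟨(g.f (i + 1)).hom, (r (i + 1)).hom, hr₁ _ (by lia), hr₂ _ (by lia)⟩
      (Iso.refl _) (by simp) (by simp [reassoc_of% hr₁ (i + 1) (by lia)])) hc

/-- The object of `K^{-,b}(P)` given by a complex. -/
def toKmb (K : CochainComplex E.ProjInj ℤ) (hK : E.minusB K) : E.Kmb :=
  ⟨(HomotopyCategory.quotient _ _).obj K, K, hK, ⟨Iso.refl _⟩⟩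

lemma exists_iso_toKmb (X : E.Kmb) : ∃ (K : CochainComplex E.ProjInj ℤ) (hK : E.minusB K),
    Nonempty (toKmb K hK ≅ X) := by
  obtain ⟨K, hK, ⟨e⟩⟩ := X.property
  exact ⟨K, hK, ⟨E.KmbProp.isoMk e⟩⟩

/-- The distinguished triangle in `K^{-,b}(P)` given by the stupid truncations. -/
lemma exists_truncation (X : CochainComplex E.ProjInj ℤ) (hX : E.minusB X) (k : ℤ) :
    ∃ (K L : CochainComplex E.ProjInj ℤ) (hK : E.bounded K) (hL : E.minusB L)
      (f : toKmb K hK.minusB ⟶ toKmb X hX) (g : toKmb X hX ⟶ toKmb L hL)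
      (h : toKmb L hL ⟶ (toKmb K hK.minusB)⟦(1 : ℤ)⟧),
      Triangle.mk f g h ∈ distTriang E.Kmb ∧
      (∀ i, i < k → IsZero (K.X i)) ∧ (∀ i, IsZero (X.X i) → IsZero (K.X i)) ∧
      (∀ i, k ≤ i → IsZero (L.X i)) ∧ (∀ i, IsZero (X.X i) → IsZero (L.X i)) ∧
      ∀ m, m < k → E.ConflationsUpTo X m → E.ConflationsUpTo L m := by
  obtain ⟨K, L, f, g, h, hK, hf, hL, hg, H⟩ := X.exists_stupid_truncation_triangle k
  have hK' : ∀ i, IsZero (X.X i) → IsZero (K.X i) := by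
    intro i hi
    by_cases h : i < k
    · exact hK i h
    · have := hf i (by lia)
      exact hi.of_iso (asIso (f.f i))
  have hL' : ∀ i, IsZero (X.X i) → IsZero (L.X i) := by
    intro i hi
    by_cases h : i < k
    · have := hg i h
      exact hi.of_iso (asIso (g.f i)).symm
    · exact hL i (by lia)
  have hL'' : ∀ m, m < k → E.ConflationsUpTo X m → E.ConflationsUpTo L m := fun m hm h =>
    h.of_isIso g (fun i hi => hg i (by lia))
  have bK : E.bounded K := ⟨⟨hX.1.choose, fun i hi => hK' i (hX.1.choose_spec i hi)⟩, k, hK⟩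
  have bL : E.minusB L := ⟨⟨hX.1.choose, fun i hi => hL' i (hX.1.choose_spec i hi)⟩,
    min hX.2.choose (k - 1), hL'' _ (by lia) (hX.2.choose_spec.mono (by lia))⟩
  obtain ⟨h', H'⟩ := E.KmbProp.exists_distTriang_fullSubcategory
    (X := toKmb K bK.minusB) (Y := toKmb X hX) (Z := toKmb L bL)
    (ObjectProperty.homMk ((HomotopyCategory.quotient _ _).map f))
    (ObjectProperty.homMk ((HomotopyCategory.quotient _ _).map g)) h H
  exact ⟨K, L, bK, bL, _, _, h', H', hK, hK', hL, hL', hL''⟩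

/-- The third object of a distinguished triangle in `K^{-,b}(P)` is the cone of a
morphism of complexes representing the first two objects. -/
lemma exists_mappingCone_iso {T : Triangle E.Kmb} (hT : T ∈ distTriang E.Kmb)
    {K L : CochainComplex E.ProjInj ℤ} (e : (HomotopyCategory.quotient _ _).obj K ≅ T.obj₁.obj)
    (e' : (HomotopyCategory.quotient _ _).obj L ≅ T.obj₂.obj) : ∃ φ : K ⟶ L,
      Nonempty ((HomotopyCategory.quotient _ _).obj (CochainComplex.mappingCone φ) ≅
        T.obj₃.obj) := by
  obtain ⟨φ, hφ⟩ := (HomotopyCategory.quotient _ _).map_surjective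
    (e.hom ≫ T.mor₁.hom ≫ e'.inv)
  refine ⟨φ, ⟨Triangle.π₃.mapIso (isoTriangleOfIso₁₂ _ (E.KmbProp.ι.mapTriangle.obj T)
    (HomotopyCategory.mappingCone_triangleh_distinguished φ)
    (E.KmbProp.ι.map_distinguished _ hT) e e' ?_)⟩⟩
  change (HomotopyCategory.quotient _ _).map φ ≫ e'.hom = e.hom ≫ T.mor₁.hom
  rw [hφ, assoc, assoc, e'.inv_hom_id, comp_id]

/-- Here the terms of `L` are used as injectives. In the lowest degree `j` where `f` may be nonzero,
`f^j` factors through `Y^j` and extends along the inflation `Y^j ⟶ K^{j+1}`. Subtracting the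
resulting null-homotopic map clears degree `j`. Only finitely many degrees occur, as `L` is bounded
below and zero in degrees `≥ 0`. -/
lemma nonempty_homotopy_zero_of_conflations {K L : CochainComplex E.ProjInj ℤ}
    (hK : E.ConflationsUpTo K 0) (hL : E.bounded L) (hL' : ∀ i, 0 ≤ i → IsZero (L.X i))
    (f : K ⟶ L) : Nonempty (Homotopy f 0) := by
  obtain ⟨Y, a, b, hK⟩ := hK
  obtain ⟨-, m, hm⟩ := hL
  suffices ∀ (n : ℕ) (f : K ⟶ L), (∀ i, i < -(n : ℤ) → f.f i = 0) → Nonempty (Homotopy f 0) from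
    this (-m).toNat f (fun i hi => (hm i (by lia)).eq_of_tgt _ _)
  intro n
  induction n with
  | zero =>
    intro f hf
    refine ⟨Homotopy.ofEq ?_⟩
    ext i : 1
    by_cases hi : i < 0
    · exact hf i (by simpa using hi)
    · exact (hL' i (by lia)).eq_of_tgt _ _
  | succ n hn =>
    intro f hf
    let j : ℤ := -((n + 1 : ℕ) : ℤ)
    have hj : j < 0 := by lia
    have hs : ∃ s : K.X (j + 1) ⟶ L.X j, K.d j (j + 1) ≫ s = f.f j := by
      have hd : ∀ i j, i + 1 = j → i < 0 → ∃ (a' : Y i ⟶ (K.X j).obj) (w : a' ≫ b j = 0),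
          (K.d i j).hom = b i ≫ a' ∧ E.conf (ShortComplex.mk a' (b j) w) := by
        rintro i _ rfl hi
        exact ⟨a i, (hK i hi).2.choose, (hK i hi).1, (hK i hi).2.choose_spec⟩
      -- Three consecutive conflations have different roles: the first makes `b (j - 1)` epi, the
      -- second presents `Y j` as a cokernel, and the third provides the inflation to extend along.
      obtain ⟨a₀, w₀, hd₀, hc₀⟩ := hd (j - 1 - 1) (j - 1) (by lia) (by lia)
      obtain ⟨a₁, w₁, hd₁, hc₁⟩ := hd (j - 1) j (by lia) (by lia)
      obtain ⟨a₂, w₂, hd₂, hc₂⟩ := hd j (j + 1) rfl hj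
      have : Epi (b (j - 1)) := conf_epi hc₀
      obtain ⟨t, ht⟩ := conf_desc hc₁ (f.f j).hom (by
        rw [← cancel_epi (b (j - 1)), comp_zero, ← assoc, ← hd₁]
        have := f.comm (j - 1) j
        rw [hf (j - 1) (by lia), zero_comp] at this
        exact (E.projInj.ι.congr_map this).symm)
      obtain ⟨s, hs⟩ := (L.X j).property.2 a₂ ⟨_, _, _, hc₂⟩ t
      refine ⟨ObjectProperty.homMk s, ObjectProperty.hom_ext _ ?_⟩
      change (K.d j (j + 1)).hom ≫ s = (f.f j).hom
      rw [hd₂, assoc, hs]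
      exact ht
    obtain ⟨s, hs⟩ := hs
    let z : CochainComplex.HomComplex.Cochain K L (-1) :=
      CochainComplex.HomComplex.Cochain.single s (-1)
    let ν : K ⟶ L := Homotopy.nullHomotopicMap'
      (fun i j hij => z.v i j (by change j + 1 = i at hij; lia))
    have hν : CochainComplex.HomComplex.δ (-1) 0 z =
      CochainComplex.HomComplex.Cochain.ofHom ν := CochainComplex.HomComplex.δ_neg_one_cochain z
    -- Up to degree `j`, the null-homotopic `ν` agrees with `f` at `j` and is zero below, so `f - ν`
    -- satisfies the induction hypothesis.
    have hν' : ∀ i, i ≤ j → ν.f i = if h : i = j then f.f i else 0 := by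
      intro i hi
      rw [← CochainComplex.HomComplex.Cochain.ofHom_v ν i, ← hν,
        CochainComplex.HomComplex.δ_v (-1) 0 (by simp) z i i (add_zero i) (i - 1) (i + 1) rfl rfl,
        CochainComplex.HomComplex.Cochain.single_v_eq_zero _ _ i _ _ (by lia)]
      split_ifs with h
      · subst h
        rw [CochainComplex.HomComplex.Cochain.single_v, hs]
        simp
      · rw [CochainComplex.HomComplex.Cochain.single_v_eq_zero _ _ (i + 1) _ _ (by lia)]
        simp
    obtain ⟨ho⟩ := hn (f - ν) (fun i hi => by
      rw [HomologicalComplex.sub_f_apply, hν' i (by lia)]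
      split_ifs with h
      · exact sub_self _
      · rw [sub_zero, hf i (by lia)])
    have ho' : Homotopy ν 0 := Homotopy.nullHomotopy' _
    exact ⟨(Homotopy.ofEq (by simp)).trans ((ho.add ho').trans (Homotopy.ofEq (by simp)))⟩

lemma homVanish_resolutions_Kneg : HomVanish E.resolutions E.Kneg := by
  rintro X Y f ⟨K, ⟨-, hK⟩, ⟨e⟩⟩ ⟨L, ⟨hL, hL'⟩, ⟨e'⟩⟩
  exact eq_zero_of_homotopy f e e' (nonempty_homotopy_zero_of_conflations hK hL hL')

lemma homVanish_Kpos_resolutions : HomVanish E.Kpos E.resolutions := by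
  rintro X Y f ⟨K, ⟨-, hK⟩, he⟩ ⟨L, ⟨hL, -⟩, he'⟩
  exact eq_zero_of_Kge_of_Kle (n := 1) (m := 0) f ⟨K, fun i hi => hK i (by lia), he⟩
    ⟨L, hL, he'⟩ (by simp)

lemma homVanish_Kpos_Kneg : HomVanish E.Kpos E.Kneg := by
  rintro X Y f ⟨K, ⟨-, hK⟩, he⟩ ⟨L, ⟨-, hL⟩, he'⟩
  exact eq_zero_of_Kge_of_Kle (n := 1) (m := -1) f ⟨K, fun i hi => hK i (by lia), he⟩
    ⟨L, fun i hi => hL i (by lia), he'⟩ (by simp)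

lemma homVanish_extensionProduct_Kneg :
    HomVanish (E.Kpos.extensionProduct E.resolutions) E.Kneg := by
  rintro T N f ⟨X, Y, a, b, c, H, hX, hY⟩ hN
  obtain ⟨s, rfl⟩ := exists_desc₂_of_mk H f (homVanish_Kpos_Kneg _ hX hN)
  rw [homVanish_resolutions_Kneg s hY hN, comp_zero]

end Pieces

end ExactStructure

namespace ExactStructure

/-! ### Generation: every object is built from the three pieces -/

section Decomposition

variable {F : Type u} [Category.{v} F] [Preadditive F] [HasZeroObject F] [HasBinaryBiproducts F]
  {E : ExactStructure F}

instance : E.Kneg.IsClosedUnderIsomorphisms := by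
  unfold Kneg; infer_instance

lemma Kneg.shift_one {X : E.Kmb} (h : E.Kneg X) : E.Kneg (X⟦(1 : ℤ)⟧) := by
  obtain ⟨K, ⟨⟨⟨p, hp⟩, ⟨q, hq⟩⟩, hK⟩, ⟨e⟩⟩ := h
  exact ⟨K⟦(1 : ℤ)⟧, ⟨⟨⟨p - 1, fun i hi => hp (i + 1) (by lia)⟩,
    ⟨q - 1, fun i hi => hq (i + 1) (by lia)⟩⟩, fun i hi => hK (i + 1) (by lia)⟩,
    ⟨shiftRepr e 1⟩⟩

open ZeroObject in
lemma Kneg_of_isZero {X : E.Kmb} (hX : IsZero X) : E.Kneg X := by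
  refine ⟨0, ⟨⟨⟨0, fun i _ => ?_⟩, ⟨0, fun i _ => ?_⟩⟩, fun i _ => ?_⟩,
    ⟨(Functor.map_isZero _ (isZero_zero _)).iso (E.KmbProp.ι.map_isZero hX)⟩⟩
  all_goals exact (HomologicalComplex.eval _ _ i).map_isZero (isZero_zero _)

open ZeroObject in
instance : E.Kneg.ContainsZero := ⟨0, isZero_zero _, Kneg_of_isZero (isZero_zero _)⟩

/-- The middle term is the cone of a map `L[-1] ⟶ K`, whose term in degree `i` is assembled from
`L^i` and `K^i`. -/
lemma extensionProduct_Kneg_Kneg_le : E.Kneg.extensionProduct E.Kneg ≤ E.Kneg := by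
  rintro T ⟨X, Y, f, g, h, H, ⟨K, ⟨⟨⟨p, hp⟩, ⟨q, hq⟩⟩, hK⟩, ⟨e⟩⟩,
    ⟨L, ⟨⟨⟨p', hp'⟩, ⟨q', hq'⟩⟩, hL⟩, ⟨e'⟩⟩⟩
  obtain ⟨φ, ⟨e₃⟩⟩ := exists_mappingCone_iso (inv_rot_of_distTriang _ H)
    (K := L⟦(-1 : ℤ)⟧) (shiftRepr e' (-1)) e
  refine ⟨_, ⟨⟨⟨max p p' + 1, fun i hi => ?_⟩, ⟨min q q' - 1, fun i hi => ?_⟩⟩,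
    fun i hi => ?_⟩, ⟨e₃⟩⟩
  · exact isZero_mappingCone_X φ i (hp' (i + 1 + -1) (by lia)) (hp _ (by lia))
  · exact isZero_mappingCone_X φ i (hq' (i + 1 + -1) (by lia)) (hq _ (by lia))
  · exact isZero_mappingCone_X φ i (hL (i + 1 + -1) (by lia)) (hK _ (by lia))

lemma isAug_id {K : CochainComplex E.ProjInj ℤ} (hK : ∀ i, i ≠ 0 → IsZero (K.X i)) :
    IsAug K (𝟙 (K.X 0).obj) where
  isZero i hi := hK i (by lia)
  deflation := E.id_deflation _
  w := by rw [(hK (-1) (by simp)).eq_of_src (K.d (-1) 0) 0]; simp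
  lift_zero h hh := ⟨0, by
    rw [comp_id] at hh
    rw [zero_comp]
    exact (ObjectProperty.hom_ext _ hh).symm⟩
  lift_neg i j k _ _ hj h _ := ⟨0, (hK j (by lia)).eq_of_tgt _ _⟩

variable [E.IsFrobenius]

lemma resolutions_embedding (A : F) : E.resolutions (E.embedding.obj A) := by
  rw [← embedding_essImage]
  exact E.embedding.obj_mem_essImage A

lemma nonempty_iso_embedding {K : CochainComplex E.ProjInj ℤ} (hK : E.minusB K)
    (h : ∀ i, i ≠ 0 → IsZero (K.X i)) :
    Nonempty (toKmb K hK ≅ E.embedding.obj (K.X 0).obj) := by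
  obtain ⟨-, e, -⟩ := (isAug_id h).exists_iso (E.isAug_resCochain (K.X 0).obj)
  exact ⟨E.KmbProp.isoMk e⟩

/-- The resolution of a projective object is isomorphic to a complex concentrated in degree `0`. -/
lemma exists_concentrated {Q : F} (hQ : E.projInj Q) :
    ∃ (K : CochainComplex E.ProjInj ℤ) (hK : E.bounded K), (∀ i, i ≠ 0 → IsZero (K.X i)) ∧
      Nonempty (toKmb K hK.minusB ≅ E.embedding.obj Q) := by
  let K := (HomologicalComplex.single E.ProjInj (ComplexShape.up ℤ) 0).obj ⟨Q, hQ⟩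
  have hK : ∀ i, i ≠ 0 → IsZero (K.X i) := fun i hi =>
    HomologicalComplex.isZero_single_obj_X _ _ _ _ hi
  have hK' : E.bounded K := ⟨⟨0, fun i hi => hK i (by lia)⟩, ⟨0, fun i hi => hK i (by lia)⟩⟩
  obtain ⟨e⟩ := nonempty_iso_embedding hK'.minusB hK
  exact ⟨K, hK', hK, ⟨e ≪≫ E.embedding.mapIso (E.projInj.ι.mapIso
    (HomologicalComplex.singleObjXSelf (ComplexShape.up ℤ) 0 (⟨Q, hQ⟩ : E.ProjInj)))⟩⟩

lemma Kneg_embedding_shift {Q : F} (hQ : E.projInj Q) :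
    E.Kneg ((E.embedding.obj Q)⟦(1 : ℤ)⟧) := by
  obtain ⟨K, hK, h, ⟨e⟩⟩ := exists_concentrated hQ
  refine E.Kneg.prop_of_iso ((shiftFunctor _ (1 : ℤ)).mapIso e) ?_
  exact ⟨K⟦(1 : ℤ)⟧, ⟨⟨⟨0, fun i hi => h (i + 1) (by lia)⟩, ⟨-1, fun i hi => h (i + 1) (by lia)⟩⟩,
    fun i hi => h (i + 1) (by lia)⟩, ⟨shiftRepr (X := toKmb K hK.minusB) (Iso.refl _) 1⟩⟩

lemma Kb_embedding {Q : F} (hQ : E.projInj Q) : E.Kb (E.embedding.obj Q) := by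
  obtain ⟨K, hK, -, ⟨e⟩⟩ := exists_concentrated hQ
  exact ⟨K, hK, ⟨E.KmbProp.ι.mapIso e⟩⟩

/-- Rotating the triangle of `A ⟶ I(A) ⟶ ΣA` twice gives `ΣA ⟶ A[1] ⟶ I(A)[1]`, and `I(A)[1]` is
concentrated in degree `-1`. -/
lemma extensionProduct_resolutions_Kneg_shift {X : E.Kmb} (hX : E.resolutions X) :
    E.resolutions.extensionProduct E.Kneg (X⟦(1 : ℤ)⟧) := by
  rw [← embedding_essImage] at hX
  obtain ⟨A, ⟨e⟩⟩ := hX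
  refine ObjectProperty.prop_of_iso _ ((shiftFunctor _ (1 : ℤ)).mapIso e) ?_
  exact ⟨_, _, _, _, _, rot_of_distTriang _ (rot_of_distTriang _
    (E.connecting_distinguished (E.hull_conf A))), resolutions_embedding _,
    Kneg_embedding_shift (E.hull_projInj A)⟩

/-- The connecting morphism goes from `F` to `K^{<0}`, so it vanishes and `T` is the image of `Q ⊞
A`. -/
lemma resolutions_of_extension {Q A : F} (hQ : E.projInj Q) {T : E.Kmb}
    {f : E.embedding.obj Q ⟶ T} {g : T ⟶ E.embedding.obj A}
    {h : E.embedding.obj A ⟶ (E.embedding.obj Q)⟦(1 : ℤ)⟧}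
    (H : Triangle.mk f g h ∈ distTriang E.Kmb) : E.resolutions T := by
  obtain ⟨e, -⟩ := exists_iso_binaryBiproduct_of_distTriang _ H
    (homVanish_resolutions_Kneg h (resolutions_embedding A) (Kneg_embedding_shift hQ))
  rw [← embedding_essImage]
  have := preservesBinaryBiproducts_of_preservesBiproducts E.embedding
  exact ⟨Q ⊞ A, ⟨E.embedding.mapBiprod Q A ≪≫ e.symm⟩⟩

/-- The number `n` counts the top degrees in which conflations may be missing. Removing the term
`K⁰` leaves `L` in degrees `< 0`, and the induction hypothesis applies to `L[-1]`. Shifting back,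
`L` lies in `F[1] * K^{<0}[1]`, hence in `F * K^{<0} * K^{<0}` and so in `F * K^{<0}`. Adding `K⁰`
on the left stays there because `P * F` lies in `F`. -/
lemma extensionProduct_toKmb (n : ℕ) (K : CochainComplex E.ProjInj ℤ) (hK : E.minusB K)
    (hK₀ : ∀ i, 0 < i → IsZero (K.X i)) (hKn : E.ConflationsUpTo K (-(n : ℤ))) :
    E.resolutions.extensionProduct E.Kneg (toKmb K hK) := by
  induction n generalizing K with
  | zero =>
    exact E.resolutions.le_extensionProduct_left E.Kneg _
      ⟨K, ⟨hK₀, by simpa using hKn⟩, ⟨Iso.refl _⟩⟩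
  | succ n hn =>
    obtain ⟨K₀, L, bK₀, bL, f, g, h, H, hK₁, hK₂, hL₁, hL₂, hL₃⟩ := exists_truncation K hK 0
    have hL₄ := hL₃ _ (by lia) hKn
    have bL' : E.minusB (L⟦(-1 : ℤ)⟧) := ⟨⟨1, fun i hi => hL₁ (i + -1) (by lia)⟩, _, hL₄.shift _⟩
    have h₁ := hn (L⟦(-1 : ℤ)⟧) bL' (fun i hi => hL₁ (i + -1) (by lia))
      ((hL₄.shift (-1)).mono (by lia))
    -- The shift of complexes agrees with the shift of `K^{-,b}(P)` only up to isomorphism, so the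
    -- passage to `L[-1]` and back is made explicit.
    have e : toKmb (L⟦(-1 : ℤ)⟧) bL' ≅ (toKmb L bL)⟦(-1 : ℤ)⟧ :=
      E.KmbProp.isoMk (shiftRepr (X := toKmb L bL) (Iso.refl _) (-1))
    have e' : toKmb L bL ≅ (toKmb (L⟦(-1 : ℤ)⟧) bL')⟦(1 : ℤ)⟧ :=
      (shiftEquiv E.Kmb (1 : ℤ)).counitIso.symm.app _ ≪≫ (shiftFunctor _ (1 : ℤ)).mapIso e.symm
    have h₂ : E.resolutions.extensionProduct E.Kneg (toKmb L bL) := by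
      refine ObjectProperty.prop_of_iso _ e'.symm ?_
      obtain ⟨X, Y, a, b, c, H', hX, hY⟩ := h₁
      refine ObjectProperty.monotone_extensionProduct_right _ extensionProduct_Kneg_Kneg_le _ ?_
      rw [← ObjectProperty.extensionProduct_assoc]
      exact ⟨_, _, _, _, _, Triangle.shift_distinguished _ H' 1,
        extensionProduct_resolutions_Kneg_shift hX, hY.shift_one⟩
    let S : ObjectProperty E.Kmb := fun X => ∃ Q, E.projInj Q ∧ Nonempty (E.embedding.obj Q ≅ X)
    have h₃ : S.extensionProduct (E.resolutions.extensionProduct E.Kneg) (toKmb K hK) := by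
      obtain ⟨e₀⟩ := nonempty_iso_embedding bK₀.minusB (fun i hi => by
        by_cases hi' : i < 0
        · exact hK₁ i hi'
        · exact hK₂ i (hK₀ i (by lia)))
      exact ⟨_, _, _, _, _, H, ⟨_, (K₀.X 0).property, ⟨e₀.symm⟩⟩, h₂⟩
    rw [← ObjectProperty.extensionProduct_assoc] at h₃
    refine ObjectProperty.monotone_extensionProduct_left _ ?_ _ h₃
    rintro T ⟨X, Y, a, b, c, H', ⟨Q, hQ, ⟨eX⟩⟩, hY⟩
    rw [← embedding_essImage] at hY
    obtain ⟨A, ⟨eY⟩⟩ := hY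
    refine resolutions_of_extension (Q := Q) (A := A) hQ (f := eX.hom ≫ a) (g := b ≫ eY.inv)
      (h := eY.hom ≫ c ≫ eX.inv⟦1⟧') (distTriang_mk_of_iso H' eX (Iso.refl _) eY (comp_id _) ?_ ?_)
    · rw [assoc, eY.inv_hom_id, comp_id]
      exact (id_comp b).symm
    · rw [assoc, assoc, ← Functor.map_comp, eX.inv_hom_id, CategoryTheory.Functor.map_id, comp_id]

lemma extensionProduct_eq_top :
    (E.Kpos.extensionProduct E.resolutions).extensionProduct E.Kneg = ⊤ := by
  rw [eq_top_iff]
  rintro X -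
  obtain ⟨K, hK, ⟨e⟩⟩ := exists_iso_toKmb X
  refine ObjectProperty.prop_of_iso _ e ?_
  rw [ObjectProperty.extensionProduct_assoc]
  -- Cutting at degree 1 puts `K₀` in `K^{>0}` and `L` in degrees `≤ 0`.
  obtain ⟨K₀, L, bK₀, bL, f, g, h, H, hK₁, hK₂, hL₁, hL₂, hL₃⟩ := exists_truncation K hK 1
  refine ⟨_, _, _, _, _, H, ⟨K₀, ⟨bK₀, fun i hi => hK₁ i (by lia)⟩, ⟨Iso.refl _⟩⟩, ?_⟩
  obtain ⟨m, hm⟩ := hK.2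
  exact extensionProduct_toKmb (-m).toNat L bL (fun i hi => hL₁ i (by lia))
    (hL₃ _ (by lia) (hm.mono (by lia)))

end Decomposition

end ExactStructure

namespace ExactStructure

/-! ### The Verdier quotient and the equivalence of categories -/

section Verdier

variable {F : Type u} [Category.{v} F] [Preadditive F] [HasZeroObject F] [HasBinaryBiproducts F]
  {E : ExactStructure F}

lemma bounded.Kb_toKmb {K : CochainComplex E.ProjInj ℤ} (hK : E.bounded K) :
    E.Kb (toKmb K hK.minusB) :=
  ⟨K, hK, ⟨Iso.refl _⟩⟩

lemma Kpos_le_Kb : E.Kpos ≤ E.Kb := by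
  rintro X ⟨K, ⟨hK, -⟩, he⟩
  exact ⟨K, hK, he⟩

lemma Kneg_le_Kb : E.Kneg ≤ E.Kb := by
  rintro X ⟨K, ⟨hK, -⟩, he⟩
  exact ⟨K, hK, he⟩

lemma exists_iso_bounded {X : E.Kmb} (hX : E.Kb X) : ∃ (K : CochainComplex E.ProjInj ℤ)
    (hK : E.bounded K), Nonempty (toKmb K hK.minusB ≅ X) := by
  obtain ⟨K, hK, ⟨e⟩⟩ := hX
  exact ⟨K, hK, ⟨E.KmbProp.isoMk e⟩⟩

lemma isIso_toVerdierQuotient_map {X Y : E.Kmb} (f : X ⟶ Y) (hf : E.Kb.trW f) :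
    IsIso (E.toVerdierQuotient.map f) :=
  Localization.inverts E.toVerdierQuotient E.Kb.trW f hf

open ZeroObject in
lemma isZero_toVerdierQuotient_obj {X : E.Kmb} (hX : E.Kb X) :
    IsZero (E.toVerdierQuotient.obj X) := by
  have : IsIso (E.toVerdierQuotient.map (0 : 0 ⟶ X)) :=
    isIso_toVerdierQuotient_map _ (ObjectProperty.trW.mk _ (contractible_distinguished₁ X) hX)
  exact (E.toVerdierQuotient.map_isZero (isZero_zero _)).of_iso
    (asIso (E.toVerdierQuotient.map (0 : 0 ⟶ X))).symm

variable [E.IsFrobenius]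

/-- A morphism between objects of `F` which factors through `K^b(P)` factors through `P`. -/
lemma exists_factorization {A B : F} {S : E.Kmb} (hS : E.Kb S) (t : E.embedding.obj A ⟶ S)
    (s : S ⟶ E.embedding.obj B) : ∃ (Q : F) (a : A ⟶ Q) (b : Q ⟶ B), E.projInj Q ∧
      t ≫ s = E.embedding.map (a ≫ b) := by
  obtain ⟨K, hK, ⟨e⟩⟩ := exists_iso_bounded hS
  -- The part in degrees `≥ 1` has no maps to `B`, so `s` factors through `L`. The part `N` of `L`
  -- in degrees `< 0` receives no maps from `A`, so `t` lifts to `M`. The complex `M` lives in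
  -- degree 0 only.
  obtain ⟨K₁, L, bK₁, bL, f, g, h, H, hK₁, -, hL₁, hL₂, -⟩ := exists_truncation K hK.minusB 1
  have bL' : E.bounded L := ⟨bL.1, hK.2.choose, fun i hi => hL₂ i (hK.2.choose_spec i hi)⟩
  obtain ⟨M, N, bM, bN, f', g', h', H', hM₁, hM₂, hN₁, hN₂, -⟩ := exists_truncation L bL 0
  obtain ⟨s', hs'⟩ := exists_desc₂_of_mk H (e.hom ≫ s)
    (eq_zero_of_Kge_of_Kle (n := 1) (m := 0) _ ⟨K₁, hK₁, ⟨Iso.refl _⟩⟩ (Kle_embedding B)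
      (by simp))
  obtain ⟨t', ht'⟩ := exists_lift₂_of_mk H' ((t ≫ e.inv) ≫ g)
    (homVanish_resolutions_Kneg _ (resolutions_embedding A)
      ⟨N, ⟨⟨bN.1, bL'.2.choose, fun i hi => hN₂ i (bL'.2.choose_spec i hi)⟩, hN₁⟩, ⟨Iso.refl _⟩⟩)
  obtain ⟨e'⟩ := nonempty_iso_embedding bM.minusB (fun i hi => by
    by_cases hi' : i < 0
    · exact hM₁ i hi'
    · exact hM₂ i (hL₁ i (by lia)))
  obtain ⟨a, ha⟩ := E.embedding.map_surjective (t' ≫ e'.hom)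
  obtain ⟨b, hb⟩ := E.embedding.map_surjective (e'.inv ≫ f' ≫ s')
  refine ⟨_, a, b, (M.X 0).property, ?_⟩
  rw [Functor.map_comp, ha, hb, assoc, e'.hom_inv_id_assoc, ← reassoc_of% ht', ← hs']
  simp

/-- If the images agree, `f - g` is killed by a morphism with cone `S` in `K^b(P)`. It then factors
through `S[-1]`, hence through `P`. Conversely, `P` becomes zero in the quotient. -/
lemma toVerdierQuotient_map_eq_iff {A B : F} (f g : A ⟶ B) :
    E.toVerdierQuotient.map (E.embedding.map f) = E.toVerdierQuotient.map (E.embedding.map g) ↔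
      E.stableRel f g := by
  constructor
  · intro h
    obtain ⟨Z, s, ⟨S, p, w, H, hS⟩, hs⟩ :=
      (MorphismProperty.map_eq_iff_postcomp E.toVerdierQuotient E.Kb.trW _ _).1 h
    have hS' : E.Kb (S⟦(-1 : ℤ)⟧) := E.Kb.le_shift (-1 : ℤ) _ hS
    obtain ⟨t, ht⟩ := Triangle.coyoneda_exact₂ _ (inv_rot_of_distTriang _ H)
      (E.embedding.map (f - g)) (by
        rw [Functor.map_sub]
        exact (Preadditive.sub_comp _ _ _).trans (sub_eq_zero.2 hs))
    obtain ⟨Q, a, b, hQ, hab⟩ := exists_factorization hS' t (Triangle.mk s p w).invRotate.mor₁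
    exact ⟨Q, a, b, hQ, E.embedding.map_injective (ht.trans hab)⟩
  · rintro ⟨Q, a, b, hQ, hab⟩
    rw [← sub_eq_zero, ← Functor.map_sub, ← Functor.map_sub, hab, Functor.map_comp,
      Functor.map_comp,
      (isZero_toVerdierQuotient_obj (Kb_embedding hQ)).eq_of_src
        (E.toVerdierQuotient.map (E.embedding.map b)) 0, comp_zero]

/-- Write `ψ` as a fraction with numerator `a` and denominator `s`, whose cone `S` is bounded. The
map from `A` to `S` factors through the truncation `K₁` of `S` in degrees `≥ 0`. The map `K₁ ⟶ S`
lifts to the target of `s`, since `Hom(K₁, B[1]) = 0`. Subtracting the resulting map through `K₁`,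
invisible in the quotient, makes `a` factor through `s`. -/
lemma exists_toVerdierQuotient_map_eq {A B : F} (ψ : E.toVerdierQuotient.obj (E.embedding.obj A) ⟶
    E.toVerdierQuotient.obj (E.embedding.obj B)) :
    ∃ f : A ⟶ B, E.toVerdierQuotient.map (E.embedding.map f) = ψ := by
  obtain ⟨⟨a, s, hs⟩, rfl⟩ := Localization.exists_leftFraction E.toVerdierQuotient E.Kb.trW ψ
  have := isIso_toVerdierQuotient_map s hs
  have hs' := hs
  obtain ⟨S, p, w, H, hS⟩ := hs'
  obtain ⟨K, hK, ⟨e⟩⟩ := exists_iso_bounded hS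
  obtain ⟨K₁, L, bK₁, bL, f, g, h, H', hK₁, -, hL₁, hL₂, -⟩ := exists_truncation K hK.minusB 0
  obtain ⟨t, ht⟩ := exists_lift₂_of_mk H' ((a ≫ p) ≫ e.inv)
    (homVanish_resolutions_Kneg _ (resolutions_embedding A)
      ⟨L, ⟨⟨bL.1, hK.2.choose, fun i hi => hL₂ i (hK.2.choose_spec i hi)⟩, hL₁⟩, ⟨Iso.refl _⟩⟩)
  obtain ⟨j, hj⟩ := exists_lift₃_of_mk H (f ≫ e.hom)
    (eq_zero_of_Kge_of_Kle (n := 0) (m := -1) _ ⟨K₁, hK₁, ⟨Iso.refl _⟩⟩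
      ((Kle_embedding B).shift 1 (-1) (by simp)) (by simp))
  obtain ⟨c, hc⟩ := exists_lift₂_of_mk H (a - t ≫ j) (by
    rw [Preadditive.sub_comp, assoc, ← hj, ← reassoc_of% ht]
    simp)
  obtain ⟨c, rfl⟩ := E.embedding.map_surjective c
  refine ⟨c, ?_⟩
  rw [← cancel_mono (E.toVerdierQuotient.map s), MorphismProperty.LeftFraction.map_comp_map_s,
    ← Functor.map_comp, ← hc, Functor.map_sub, Functor.map_comp,
    (isZero_toVerdierQuotient_obj bK₁.Kb_toKmb).eq_of_tgt (E.toVerdierQuotient.map t) 0,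
    zero_comp, sub_zero]

/-- In the decomposition of a preimage of `X`, the two outer pieces are bounded. The quotient
therefore sees only the middle piece, which comes from `F`. -/
lemma exists_iso_toVerdierQuotient_obj (X : E.VerdierQuotient) :
    ∃ A : F, Nonempty (E.toVerdierQuotient.obj (E.embedding.obj A) ≅ X) := by
  have := Localization.essSurj E.toVerdierQuotient E.Kb.trW
  obtain ⟨T, ⟨eT⟩⟩ : ∃ T, Nonempty (E.toVerdierQuotient.obj T ≅ X) :=
    ⟨_, ⟨E.toVerdierQuotient.objObjPreimageIso X⟩⟩
  obtain ⟨T', N, f, g, h, H, ⟨P, R, f', g', h', H', hP, hR⟩, hN⟩ :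
      (E.Kpos.extensionProduct E.resolutions).extensionProduct E.Kneg T := by
    rw [extensionProduct_eq_top]; trivial
  rw [← embedding_essImage] at hR
  obtain ⟨A, ⟨eA⟩⟩ := hR
  have := isIso_toVerdierQuotient_map f (ObjectProperty.trW.mk _ H (Kneg_le_Kb _ hN))
  have := isIso_toVerdierQuotient_map g' (ObjectProperty.trW.mk' _ H' (Kpos_le_Kb _ hP))
  exact ⟨A, ⟨E.toVerdierQuotient.mapIso eA ≪≫ (asIso (E.toVerdierQuotient.map g')).symm ≪≫
    asIso (E.toVerdierQuotient.map f) ≪≫ eT⟩⟩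

variable (E)

/-- The functor from the stable category to the Verdier quotient induced by the embedding. -/
noncomputable def stableToVerdier : E.Stable ⥤ E.VerdierQuotient :=
  CategoryTheory.Quotient.lift E.stableRel (E.embedding ⋙ E.toVerdierQuotient)
    (fun _ _ _ _ h => (toVerdierQuotient_map_eq_iff _ _).2 h)

lemma toStable_comp_stableToVerdier :
    E.toStable ⋙ E.stableToVerdier = E.embedding ⋙ E.toVerdierQuotient :=
  CategoryTheory.Quotient.lift_spec _ _ _

instance : E.stableToVerdier.Full where
  map_surjective {X Y} ψ := by
    obtain ⟨f, hf⟩ := exists_toVerdierQuotient_map_eq (A := X.as) (B := Y.as) ψ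
    exact ⟨E.toStable.map f, hf⟩

instance : E.stableToVerdier.Faithful where
  map_injective {X Y f g} h := by
    obtain ⟨f, rfl⟩ := E.toStable.map_surjective (X := X.as) (Y := Y.as) f
    obtain ⟨g, rfl⟩ := E.toStable.map_surjective (X := X.as) (Y := Y.as) g
    exact CategoryTheory.Quotient.sound _ ((toVerdierQuotient_map_eq_iff f g).1 h)

instance : E.stableToVerdier.EssSurj where
  mem_essImage X := by
    obtain ⟨A, he⟩ := exists_iso_toVerdierQuotient_obj X
    exact ⟨E.toStable.obj A, he⟩

instance : E.stableToVerdier.IsEquivalence where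

end Verdier

end ExactStructure

namespace ExactStructure

/-! ### Comparison of the triangulated structures -/

section Happel

variable {F : Type u} [Category.{v} F] [Preadditive F] {E : ExactStructure F}

/-- The cokernel of a pushout of an inflation. -/
lemma mono_and_lift_of_isPushout {A B I C S : F} {u : A ⟶ B} {i : A ⟶ I} {v : B ⟶ C} {x : I ⟶ C}
    (sq : IsPushout u i v x) {p : I ⟶ S} {zero : i ≫ p = 0} (hc : E.conf (ShortComplex.mk i p zero))
    {w : C ⟶ S} (hv : v ≫ w = 0) (hx : x ≫ w = p) :
    Mono v ∧ ∀ {T : F} (t : T ⟶ C), t ≫ w = 0 → ∃ l : T ⟶ B, l ≫ v = t := by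
  -- The exact structure provides a pushout that is an inflation, and the given square is isomorphic
  -- to it. Its deflation `g` factors through `w`, so whatever `w` kills is killed by `g` and lifts
  -- to `B`.
  obtain ⟨C', x', v', sq', Z, g, hg, hc'⟩ := E.pushout_inflation i u ⟨_, _, _, hc⟩
  let e : C ≅ C' := sq.flip.isoIsPushout _ _ sq'
  have he : v ≫ e.hom = v' := IsPushout.inr_isoIsPushout_hom _ _ sq.flip sq'
  have he' : x ≫ e.hom = x' := IsPushout.inl_isoIsPushout_hom _ _ sq.flip sq'
  have : Mono v' := conf_mono hc'
  have hmono : Mono v := by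
    rw [← he] at this
    exact mono_of_mono v e.hom
  obtain ⟨k, hk⟩ := conf_desc hc (x' ≫ g) (by
    dsimp
    rw [← assoc, sq'.w, assoc, hg, comp_zero])
  have hw : w ≫ k = e.hom ≫ g := by
    apply sq.hom_ext
    · rw [reassoc_of% hv, zero_comp, reassoc_of% he, hg]
    · rw [reassoc_of% hx, reassoc_of% he']
      exact hk
  refine ⟨hmono, fun t ht => ?_⟩
  obtain ⟨l, hl⟩ := conf_lift hc' (t ≫ e.hom) (by
    dsimp
    rw [assoc, ← hw, reassoc_of% ht, zero_comp])
  refine ⟨l, ?_⟩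
  rw [← cancel_mono e.hom, assoc, he]
  exact hl

variable [HasZeroObject F] [HasBinaryBiproducts F]

/-- The conflation attached to the pushout of an inflation. -/
lemma conf_of_isPushout {A B I C S : F} {u : A ⟶ B} {i : A ⟶ I} {v : B ⟶ C} {x : I ⟶ C}
    (sq : IsPushout u i v x) {p : I ⟶ S} {zero : i ≫ p = 0} (hc : E.conf (ShortComplex.mk i p zero))
    {w : C ⟶ S} (hv : v ≫ w = 0) (hx : x ≫ w = p) :
    ∃ h : biprod.lift u (-i) ≫ biprod.desc v x = 0,
      E.conf (ShortComplex.mk (biprod.lift u (-i)) (biprod.desc v x) h) := by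
  obtain ⟨_, hlift⟩ := mono_and_lift_of_isPushout sq hc hv hx
  have : Mono i := conf_mono hc
  have h : biprod.lift u (-i) ≫ biprod.desc v x = 0 := by
    rw [biprod.lift_desc, sq.w, Preadditive.neg_comp, add_neg_cancel]
  -- This map is the pullback of the deflation `p` along `w`.
  have hd : E.IsDeflation (biprod.desc v x) := by
    refine deflation_of_isPullback (isPullback_of (biprod.snd : B ⊞ I ⟶ I) (biprod.desc v x)
      p w (by ext <;> simp [hv, hx]) ?_ ?_) ⟨_, _, _, hc⟩
    · intro T a b hab
      obtain ⟨l, hl⟩ := hlift (b - a ≫ x) (by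
        rw [Preadditive.sub_comp, assoc, hx, hab, sub_self])
      exact ⟨biprod.lift l a, by simp, by simp [biprod.lift_desc, hl]⟩
    · intro T l l' h₁ h₂
      ext
      · rw [← cancel_mono v]
        have h₃ : ∀ m : T ⟶ B ⊞ I, m ≫ biprod.desc v x =
            (m ≫ biprod.fst) ≫ v + (m ≫ biprod.snd) ≫ x := fun m => by
          rw [biprod.desc_eq]; simp
        rw [h₃, h₃, h₁] at h₂
        exact add_right_cancel h₂
      · exact h₁
  have : Mono (biprod.lift u (-i)) := by
    have : Mono (biprod.lift u (-i) ≫ (biprod.snd : B ⊞ I ⟶ I)) := by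
      rw [biprod.lift_snd]; infer_instance
    exact mono_of_mono _ (biprod.snd : B ⊞ I ⟶ I)
  refine ⟨h, conf_of_deflation _ _ h hd ?_⟩
  intro T t ht
  have h₁ : (t ≫ biprod.fst) ≫ v + (t ≫ biprod.snd) ≫ x = 0 := by
    rw [biprod.desc_eq] at ht
    simpa using ht
  obtain ⟨l, hl⟩ := conf_lift hc (t ≫ biprod.snd) (by
    have := h₁ =≫ w
    simpa only [Preadditive.add_comp, assoc, hv, hx, comp_zero, zero_add, zero_comp] using this)
  dsimp at hl
  refine ⟨-l, ?_⟩
  ext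
  · have h₂ : ((-l) ≫ biprod.lift u (-i)) ≫ biprod.fst = -(l ≫ u) := by simp
    rw [← cancel_mono v, h₂, Preadditive.neg_comp, assoc, sq.w, ← assoc, hl]
    exact neg_eq_of_add_eq_zero_left h₁
  · simp [hl]

variable (E) [E.IsFrobenius]

/-- The comparison of Happel's suspension with the shift of the Verdier quotient. -/
noncomputable def suspComparison (A : F) :
    E.toVerdierQuotient.obj (E.embedding.obj (E.cosyz A)) ⟶
      (E.toVerdierQuotient.obj (E.embedding.obj A))⟦(1 : ℤ)⟧ :=
  -- The sign compensates for the `-ι` in the conflation `A ⟶ B ⊕ I(A) ⟶ C` attached to a pushout.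
  -(E.toVerdierQuotient.map (E.connecting (E.hull_conf A)) ≫
    (E.toVerdierQuotient.commShiftIso (1 : ℤ)).hom.app (E.embedding.obj A))

/-- The middle term `I(A)` of the triangle vanishes in the quotient, so the connecting morphism
becomes invertible. -/
instance isIso_suspComparison (A : F) : IsIso (E.suspComparison A) := by
  have H := E.toVerdierQuotient.map_distinguished _ (E.connecting_distinguished (E.hull_conf A))
  have : IsIso (E.toVerdierQuotient.map (E.connecting (E.hull_conf A)) ≫
      (E.toVerdierQuotient.commShiftIso (1 : ℤ)).hom.app (E.embedding.obj A)) :=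
    (Triangle.isZero₂_iff_isIso₃ _ H).1
      (isZero_toVerdierQuotient_obj (Kb_embedding (E.hull_projInj A)))
  exact ⟨-inv (E.toVerdierQuotient.map (E.connecting (E.hull_conf A)) ≫
      (E.toVerdierQuotient.commShiftIso (1 : ℤ)).hom.app (E.embedding.obj A)),
    (Preadditive.neg_comp_neg _ _).trans (IsIso.hom_inv_id _),
    (Preadditive.neg_comp_neg _ _).trans (IsIso.inv_hom_id _)⟩

lemma suspComparison_naturality {A B : F} (f : A ⟶ B) (s : E.cosyz A ⟶ E.cosyz B)
    (hs : E.IsSuspMap f s) :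
    E.toVerdierQuotient.map (E.embedding.map s) ≫ E.suspComparison B =
      E.suspComparison A ≫ (E.toVerdierQuotient.map (E.embedding.map f))⟦(1 : ℤ)⟧' := by
  obtain ⟨k, hk, hk'⟩ := hs
  have h := E.connecting_naturality (E.hull_conf A) (E.hull_conf B) f k s hk hk'
  rw [suspComparison, suspComparison, Preadditive.comp_neg, Preadditive.neg_comp, neg_inj,
    ← assoc, ← Functor.map_comp, h, Functor.map_comp, assoc, assoc]
  congr 1
  exact (E.toVerdierQuotient.commShiftIso (1 : ℤ)).hom.naturality (E.embedding.map f)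

/-- The compatibility of `stableToVerdier` with the suspension functors. -/
noncomputable def suspIso :
    E.susp ⋙ E.stableToVerdier ≅ E.stableToVerdier ⋙ shiftFunctor E.VerdierQuotient (1 : ℤ) :=
  NatIso.ofComponents
    (fun X => @asIso _ _ _ _ (E.suspComparison X.as) (E.isIso_suspComparison X.as)) (by
    intro X Y f
    obtain ⟨f, rfl⟩ := E.toStable.map_surjective (X := X.as) (Y := Y.as) f
    exact E.suspComparison_naturality f _ (E.exists_suspMap f).choose_spec)

/-- The image of a standard Happel triangle is distinguished. -/
lemma distinguished_of_isPushout {A B C : F} {u : A ⟶ B} {v : B ⟶ C} {x : E.hull A ⟶ C}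
    {w : C ⟶ E.cosyz A} (sq : IsPushout u (E.hullι A) v x) (hv : v ≫ w = 0)
    (hx : x ≫ w = E.hullπ A) :
    Triangle.mk (E.stableToVerdier.map (E.toStable.map u))
      (E.stableToVerdier.map (E.toStable.map v))
      (E.stableToVerdier.map (E.toStable.map w) ≫ E.suspIso.hom.app (E.toStable.obj A)) ∈
      distTriang E.VerdierQuotient := by
  obtain ⟨h, hc⟩ := conf_of_isPushout sq (E.hull_conf A) hv hx
  have hI : E.projInj (E.hull A) := E.hull_projInj A
  have H := E.toVerdierQuotient.map_distinguished _ (E.connecting_distinguished hc)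
  -- Since `I(A)` dies in the quotient, the inclusion of `B` into `B ⊞ I(A)` becomes an isomorphism.
  let e : E.toVerdierQuotient.obj (E.embedding.obj B) ≅
      E.toVerdierQuotient.obj (E.embedding.obj (B ⊞ E.hull A)) :=
    { hom := E.toVerdierQuotient.map (E.embedding.map biprod.inl)
      inv := E.toVerdierQuotient.map (E.embedding.map biprod.fst)
      hom_inv_id := by
        rw [← Functor.map_comp, ← Functor.map_comp, biprod.inl_fst,
          CategoryTheory.Functor.map_id, CategoryTheory.Functor.map_id]
      inv_hom_id := by
        rw [← Functor.map_comp, ← Functor.map_comp, ← CategoryTheory.Functor.map_id,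
          ← CategoryTheory.Functor.map_id, toVerdierQuotient_map_eq_iff]
        refine ⟨_, -biprod.snd, biprod.inr, hI, ?_⟩
        rw [← biprod.total, Preadditive.neg_comp]
        abel }
  refine distTriang_mk_of_iso
    (f := E.toVerdierQuotient.map (E.embedding.map (biprod.lift u (-E.hullι A))))
    (g := E.toVerdierQuotient.map (E.embedding.map (biprod.desc v x)))
    (h := E.toVerdierQuotient.map (E.connecting hc) ≫
      (E.toVerdierQuotient.commShiftIso (1 : ℤ)).hom.app (E.embedding.obj A)) H
    (Iso.refl _) e (Iso.refl _) ?_ ?_ ?_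
  · refine Eq.trans ?_ (id_comp _).symm
    change E.toVerdierQuotient.map (E.embedding.map u) ≫
      E.toVerdierQuotient.map (E.embedding.map biprod.inl) = _
    rw [← Functor.map_comp, ← Functor.map_comp, toVerdierQuotient_map_eq_iff]
    exact ⟨_, E.hullι A, biprod.inr, hI, by ext <;> simp⟩
  · refine (comp_id _).trans ?_
    change E.toVerdierQuotient.map (E.embedding.map v) =
      E.toVerdierQuotient.map (E.embedding.map biprod.inl) ≫ _
    rw [← Functor.map_comp, ← Functor.map_comp, biprod.inl_desc]
  -- The second projection maps this conflation to `A ⟶ I(A) ⟶ ΣA`, with `-𝟙` on `A`. This sign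
  -- cancels the one in `suspComparison`.
  · have hn := E.connecting_naturality hc (E.hull_conf A) (-𝟙 A) biprod.snd w (by simp)
      (by ext <;> simp [hv, hx])
    rw [Functor.map_neg, Functor.map_neg, CategoryTheory.Functor.map_id,
      CategoryTheory.Functor.map_id, Preadditive.comp_neg, comp_id] at hn
    refine (congrArg (_ ≫ ·) ((shiftFunctor E.VerdierQuotient (1 : ℤ)).map_id _)).trans ?_
    refine (comp_id _).trans (Eq.trans ?_ (id_comp _).symm)
    change E.toVerdierQuotient.map (E.embedding.map w) ≫ E.suspComparison A =
      E.toVerdierQuotient.map (E.connecting hc) ≫ _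
    rw [suspComparison, Preadditive.comp_neg, ← assoc, ← Functor.map_comp, hn, Functor.map_neg,
      Preadditive.neg_comp, neg_neg]

/-- For the converse, a representative of `f` is completed to a standard triangle by a pushout. The
two third objects are isomorphic in the quotient because cones are unique, and this isomorphism
lifts along the fully faithful functor. -/
lemma isHappelTriangle_iff {X Y Z : E.Stable} (f : X ⟶ Y) (g : Y ⟶ Z)
    (h : Z ⟶ E.susp.obj X) : E.IsHappelTriangle f g h ↔
      Triangle.mk (E.stableToVerdier.map f) (E.stableToVerdier.map g)
        (E.stableToVerdier.map h ≫ E.suspIso.hom.app X) ∈ distTriang E.VerdierQuotient := by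
  constructor
  · rintro ⟨A, B, C, u, v, x, w, e₁, e₂, e₃, sq, hv, hx, h₁, h₂, h₃⟩
    refine distTriang_mk_of_iso (E.distinguished_of_isPushout sq hv hx)
      (E.stableToVerdier.mapIso e₁) (E.stableToVerdier.mapIso e₂) (E.stableToVerdier.mapIso e₃)
      ?_ ?_ ?_
    · simp only [Functor.mapIso_hom, ← Functor.map_comp, h₁]
    · simp only [Functor.mapIso_hom, ← Functor.map_comp, h₂]
    · have hn := E.suspIso.hom.naturality e₁.hom
      dsimp only [Functor.comp_map] at hn
      rw [Functor.mapIso_hom, Functor.mapIso_hom, assoc, ← hn, ← assoc, ← Functor.map_comp, h₃]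
      exact (congrArg (· ≫ E.suspIso.hom.app (E.toStable.obj A))
        (E.stableToVerdier.map_comp e₃.hom (E.toStable.map w))).trans (assoc _ _ _)
  · intro H
    obtain ⟨u, rfl⟩ := E.toStable.map_surjective (X := X.as) (Y := Y.as) f
    obtain ⟨C, x, v, sq, -⟩ := E.pushout_inflation (E.hullι X.as) u ⟨_, _, _, E.hull_conf X.as⟩
    have hw : u ≫ (0 : Y.as ⟶ E.cosyz X.as) = E.hullι X.as ≫ E.hullπ X.as := by
      rw [comp_zero, hull_w]
    let w : C ⟶ E.cosyz X.as := sq.flip.desc 0 (E.hullπ X.as) hw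
    have hv : v ≫ w = 0 := sq.flip.inl_desc _ _ _
    have hx : x ≫ w = E.hullπ X.as := sq.flip.inr_desc _ _ _
    obtain ⟨e, he, he'⟩ := exists_iso₃_of_mk H (E.distinguished_of_isPushout sq.flip hv hx)
    refine ⟨X.as, Y.as, C, u, v, x, w, Iso.refl _, Iso.refl _, E.stableToVerdier.preimageIso e,
      sq.flip, hv, hx, ?_, ?_, ?_⟩
    · exact (comp_id _).trans (id_comp _).symm
    · refine Eq.trans ?_ (id_comp _).symm
      apply E.stableToVerdier.map_injective
      rw [Functor.map_comp, Functor.preimageIso_hom, Functor.map_preimage, he]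
    · apply E.stableToVerdier.map_injective
      rw [← cancel_mono (E.suspIso.hom.app (E.toStable.obj X.as))]
      refine (congrArg (fun k => E.stableToVerdier.map k ≫ E.suspIso.hom.app X)
        ((congrArg (h ≫ ·) (E.susp.map_id X)).trans (comp_id h))).trans (he'.trans ?_)
      refine Eq.symm ((congrArg (· ≫ E.suspIso.hom.app X) ((E.stableToVerdier.map_comp
        (E.stableToVerdier.preimage e.hom) (E.toStable.map w)).trans
          (congrArg (· ≫ _) (E.stableToVerdier.map_preimage e.hom)))).trans (assoc _ _ _))

end Happel

end ExactStructure

theorem corollary2p2 {F : Type u} [Category.{v} F] [Preadditive F] [HasZeroObject F]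
    [HasBinaryBiproducts F] (E : ExactStructure F) [E.IsFrobenius]
    [IsIdempotentComplete E.ProjInj] :
    -- `F` is identified with a full subcategory of `K^{-,b}(P)`
    (E.embedding.Full ∧ E.embedding.Faithful ∧ E.embedding.essImage = E.resolutions) ∧
    -- the decomposition `K^{-,b}(P) = K^{>0}(P) ⊥ F ⊥ K^{<0}(P)`
    (ExactStructure.HomVanish E.Kpos E.resolutions ∧
      ExactStructure.HomVanish (E.Kpos.extensionProduct E.resolutions) E.Kneg ∧
      (E.Kpos.extensionProduct E.resolutions).extensionProduct E.Kneg = ⊤) ∧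
    -- `F ⟶ K^{-,b}(P) ⟶ K^{-,b}(P)/K^b(P)` induces a triangle equivalence
    ∃ (Φ : E.Stable ⥤ E.VerdierQuotient)
      (φ : E.susp ⋙ Φ ≅ Φ ⋙ shiftFunctor E.VerdierQuotient (1 : ℤ)),
      E.toStable ⋙ Φ = E.embedding ⋙ E.toVerdierQuotient ∧
      Φ.IsEquivalence ∧
      ∀ (X Y Z : E.Stable) (f : X ⟶ Y) (g : Y ⟶ Z) (h : Z ⟶ E.susp.obj X),
        E.IsHappelTriangle f g h ↔
          Triangle.mk (Φ.map f) (Φ.map g) (Φ.map h ≫ φ.hom.app X) ∈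
            distTriang E.VerdierQuotient :=
  ⟨⟨inferInstance, inferInstance, E.embedding_essImage⟩,
    ⟨ExactStructure.homVanish_Kpos_resolutions, ExactStructure.homVanish_extensionProduct_Kneg,
      ExactStructure.extensionProduct_eq_top⟩,
    E.stableToVerdier, E.suspIso, E.toStable_comp_stableToVerdier, inferInstance,
    fun _ _ _ f g h => E.isHappelTriangle_iff f g h⟩
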